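/- For a finite unweighted graph $H$ (multiple edges are allowed, loops are ignored) with vertices $v_1,\dots,v_n$, let $a_{ij}$ be the number of edges between $v_i$ and $v_j$ for $i\neq j$ and $a_{ii}=0$, let $A=(a_{ij})$, and let $\delta$ be the diagonal matrix with entries $\delta_{ii}=\sum_j a_{ij}$. The complexity $\kappa_H$ is the order of the torsion subgroup of the abelian group presented by the Laplacian matrix $\delta-A$. For $d\ge 1$ let $\mathbb G_d$ be the $d$-dimensional grid graph: the unweighted graph with vertex set $\mathbb Z^d$ in which two vertices are joined by one edge exactly when they differ by $1$ in one coordinate and agree in all others. The group $\mathbb Z^d$ acts on $\mathbb G_d$ by translation; for a subgroup $\Lambda\subset\mathbb Z^d$ of finite index let $(\mathbb G_d)_\Lambda$ be the finite quotient graph, whose vertices and edges are the $\Lambda$-orbits of vertices and edges of $\mathbb G_d$, and let $\langle\Lambda\rangle$ be the minimum Euclidean length of a nonzero vector of $\Lambda$. Theorem. For every $d\ge 1$ the complexity growth rate $$\gamma_{\mathbb G_d}=\lim_{\langle\Lambda\rangle\to\infty}\frac{1}{|\mathbb Z^d/\Lambda|}\log\kappa_{(\mathbb G_d)_\Lambda},$$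 where $\Lambda$ ranges over all finite-index subgroups of $\mathbb Z^d$, exists as a real number, and (1) $\gamma_{\mathbb G_d}\le\log(2d)$ for all $d\ge 1$; (2) $\lim_{d\to\infty}\bigl(\gamma_{\mathbb G_d}-\log(2d)\bigr)=0$. -/

import Mathlib

/-- An unweighted graph with vertex set `V` and edge set `E`; multiple edges and loops are allowed.
`ends e` is the unordered pair of end points of the edge `e`. -/
structure Multigraph (V E : Type*) where
  ends : E → Sym2 V

namespace Multigraph

variable {V E : Type*}

/-- The adjacency matrix: off the diagonal, the number of edges between `i` and `j`;
on the diagonal zero, that is, loops are ignored. -/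
noncomputable def adjacency (G : Multigraph V E) : Matrix V V ℤ :=
  open Classical in
  Matrix.of fun i j => if i = j then 0 else (Nat.card {e : E // G.ends e = s(i, j)} : ℤ)

/-- The Laplacian matrix `δ - A`, with `δ` the diagonal matrix of the row sums of `A`. -/
noncomputable def laplacian [Fintype V] (G : Multigraph V E) : Matrix V V ℤ :=
  open Classical in
  Matrix.diagonal (fun i => ∑ j, G.adjacency i j) - G.adjacency

/-- The Laplacian group: the abelian group presented by the (symmetric) Laplacian matrix. -/
abbrev LaplacianGroup [Fintype V] (G : Multigraph V E) : Type _ :=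
  (V → ℤ) ⧸ LinearMap.range G.laplacian.mulVecLin

/-- The (torsion) complexity: the order of the torsion subgroup of the Laplacian group. -/
noncomputable def complexity [Fintype V] (G : Multigraph V E) : ℕ :=
  Nat.card (AddCommGroup.torsion G.LaplacianGroup)

end Multigraph

/-- A `d`-periodic graph: a graph with a free action of `ℤ^d` by graph automorphisms, with
finitely many orbits of vertices and of edges. -/
structure PeriodicGraph (d : ℕ) (V E : Type*) [AddAction (Fin d → ℤ) V]
    [AddAction (Fin d → ℤ) E] extends Multigraph V E where
  ends_vadd : ∀ (s : Fin d → ℤ) (e : E), ends (s +ᵥ e) = (ends e).map (s +ᵥ ·)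
  free_vertex : ∀ (s : Fin d → ℤ) (v : V), s +ᵥ v = v → s = 0
  free_edge : ∀ (s : Fin d → ℤ) (e : E), s +ᵥ e = e → s = 0
  finite_vertex : Finite (AddAction.orbitRel.Quotient (Fin d → ℤ) V)
  finite_edge : Finite (AddAction.orbitRel.Quotient (Fin d → ℤ) E)

namespace PeriodicGraph

variable {d : ℕ} {V E : Type*} [AddAction (Fin d → ℤ) V] [AddAction (Fin d → ℤ) E]

/-- The quotient graph `G_Λ` of a periodic graph by a subgroup `Λ` of `ℤ^d`: its vertices and
edges are the `Λ`-orbits of vertices and of edges of `G`. -/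
def quotient (G : PeriodicGraph d V E) (Λ : AddSubgroup (Fin d → ℤ)) :
    Multigraph (AddAction.orbitRel.Quotient Λ V) (AddAction.orbitRel.Quotient Λ E) where
  ends := Quotient.lift
    (fun e => (G.ends e).map (Quotient.mk (AddAction.orbitRel Λ V))) (by
      rintro _ e ⟨s, rfl⟩
      have h : (G.ends (s +ᵥ e)) = (G.ends e).map ((s : Fin d → ℤ) +ᵥ ·) := G.ends_vadd s e
      simp only [h, Sym2.map_map]
      congr 1
      funext v
      exact Quotient.sound ⟨s, rfl⟩)

theorem finite_quotient_vertex (G : PeriodicGraph d V E) (Λ : AddSubgroup (Fin d → ℤ))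
    [Λ.FiniteIndex] : Finite (AddAction.orbitRel.Quotient Λ V) := by
  have := G.finite_vertex
  refine Finite.of_surjective
    (fun p : ((Fin d → ℤ) ⧸ Λ) × AddAction.orbitRel.Quotient (Fin d → ℤ) V =>
      (Quotient.mk _ (p.1.out +ᵥ p.2.out) : AddAction.orbitRel.Quotient Λ V)) ?_
  intro q
  induction q using Quotient.inductionOn with
  | h v =>
    obtain ⟨s, hs⟩ : ∃ s : Fin d → ℤ, s +ᵥ
        (Quotient.mk _ v : AddAction.orbitRel.Quotient (Fin d → ℤ) V).out = v :=
      (AddAction.orbitRel (Fin d → ℤ) V).symm (Quotient.mk_out v)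
    refine ⟨(QuotientAddGroup.mk s, Quotient.mk _ v), ?_⟩
    obtain ⟨l, hl⟩ := QuotientAddGroup.mk_out_eq_add Λ s
    refine Quotient.sound ⟨l, ?_⟩
    dsimp only
    rw [hl, add_comm s, add_vadd, hs]
    rfl

/-- The complexity of the finite graph `G_Λ`, for `Λ` of finite index. -/
noncomputable def quotientComplexity (G : PeriodicGraph d V E) (Λ : AddSubgroup (Fin d → ℤ))
    [Λ.FiniteIndex] : ℕ :=
  haveI := G.finite_quotient_vertex Λ
  haveI := Fintype.ofFinite (AddAction.orbitRel.Quotient Λ V)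
  (G.quotient Λ).complexity

end PeriodicGraph

/-- `⟨Λ⟩`: the minimum Euclidean length of a nonzero vector in `Λ`. -/
noncomputable def minLength {d : ℕ} (Λ : AddSubgroup (Fin d → ℤ)) : ℝ :=
  sInf {ℓ : ℝ | ∃ s ∈ Λ, s ≠ 0 ∧ ℓ = √(∑ i, (s i : ℝ) ^ 2)}

/-- The subgroups of finite index in `ℤ^d`. -/
abbrev FiniteIndexSubgroup (d : ℕ) : Type :=
  {Λ : AddSubgroup (Fin d → ℤ) // Λ.FiniteIndex}

/-- The filter `⟨Λ⟩ → ∞` on the subgroups of finite index in `ℤ^d`. -/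
noncomputable def minLengthAtTop (d : ℕ) : Filter (FiniteIndexSubgroup d) :=
  Filter.comap (fun Λ => minLength Λ.1) Filter.atTop

namespace PeriodicGraph

variable {d : ℕ} {V E : Type*} [AddAction (Fin d → ℤ) V] [AddAction (Fin d → ℤ) E]

/-- `(1 / |ℤ^d / Λ|) log κ(G_Λ)`. -/
noncomputable def logComplexityDensity (G : PeriodicGraph d V E) (Λ : FiniteIndexSubgroup d) : ℝ :=
  haveI := Λ.2
  1 / (Λ.1.index : ℝ) * Real.log (G.quotientComplexity Λ.1)

/-- The complexity growth rate `γ_G`, as an upper limit for `⟨Λ⟩ → ∞`. -/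
noncomputable def growthRate (G : PeriodicGraph d V E) : ℝ :=
  Filter.limsup G.logComplexityDensity (minLengthAtTop d)

end PeriodicGraph

/-- The edges of the `d`-dimensional grid: the edge with base point `s` and direction `i` joins
`s` to `s + e_i`. -/
@[ext]
structure GridEdge (d : ℕ) where
  base : Fin d → ℤ
  dir : Fin d

/-- `ℤ^d` acts on the edges of the grid by translation. -/
instance (d : ℕ) : AddAction (Fin d → ℤ) (GridEdge d) where
  vadd s e := ⟨s + e.base, e.dir⟩
  zero_vadd e := GridEdge.ext (zero_add e.base) rfl
  add_vadd s t e := GridEdge.ext (add_assoc s t e.base) rfl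

/-- The `d`-dimensional grid graph, with `ℤ^d` acting by translation. -/
def gridGraph (d : ℕ) : PeriodicGraph d (Fin d → ℤ) (GridEdge d) where
  ends e := s(e.base, e.base + Pi.single e.dir 1)
  ends_vadd s e := by
    change s(s + e.base, s + e.base + Pi.single e.dir 1) =
      s(s + e.base, s + (e.base + Pi.single e.dir 1))
    rw [add_assoc]
  free_vertex s v h := by simpa using h
  free_edge s e h := by
    have h' : s + e.base = e.base := congrArg GridEdge.base h
    simpa using h'
  finite_vertex := by
    refine Finite.of_surjective (fun _ : Unit => Quotient.mk _ 0) fun q => ⟨(), ?_⟩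
    induction q using Quotient.inductionOn with
    | h v => exact Quotient.sound ⟨-v, by simp⟩
  finite_edge := by
    refine Finite.of_surjective (fun i : Fin d => Quotient.mk _ ⟨0, i⟩) fun q => ?_
    induction q using Quotient.inductionOn with
    | h e =>
      exact ⟨e.dir, Quotient.sound ⟨-e.base, GridEdge.ext (neg_add_cancel e.base) rfl⟩⟩

/-!
The quotient of the grid by `Λ` is, up to loops, the Cayley multigraph of `A = ℤ^d / Λ`, so its
Laplacian is diagonalized by the characters of `A`. By the matrix-tree theorem
(`Multigraph.card_sq_mul_complexity`, `det_cayleyLaplacian_add_ones`) the complexity is the product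
of the nonzero eigenvalues divided by `N = |A|`. The eigenvalue at a character `ψ` is
`4d (1 - b ψ)`, with `b ψ ∈ [0, 1]` the Fourier coefficient of the lazy simple random walk
(`lazySymbol`), and expanding the logarithm gives
`log κ / N = (1 - 1/N) log (4d) - ∑ n ≥ 1, (1/N) (∑ ψ ≠ 0, (b ψ)^n) / n - log N / N`.

For fixed `n` the mean of `(b ψ)^n` over all `ψ` is the return probability of the walk on `A`, which
for large `⟨Λ⟩` is the return probability `q n` on `ℤ^d`. For the sum over `n` to converge to
`∑ q n / n`, a domination uniform in `Λ` is needed. It comes from `c ^ n ≤ (n (1 - c)) ^ (-1/4)` and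
from bounding `1 - b ψ` below through a single generator on which `ψ` is nontrivial: the values of
the characters at one element are equidistributed among roots of unity, where `|sin| ^ (-1/2)` has
bounded Riemann sums. The terms are thus `O(n ^ (-5/4))`, with a constant depending only on `d`, and
`γ_d = log (4d) - ∑ n ≥ 1, q n / n` (`growthRate_gridGraph`).

Jensen's inequality gives `q n ≥ 2 ^ (-n)`, and `∑ 2 ^ (-n) / n = log 2`, whence `γ_d ≤ log (2d)`.
As `b` has mean `1/2` and variance `1 / (8d)`, also `q n → 2 ^ (-n)` as `d → ∞`. Convexity in the
generators gives `q n ≤ 4 n ^ (-1/4)` independently of `d`, so dominated convergence yields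
`γ_d - log (2d) → 0`.
-/

open Filter Topology

/-! ### Integer matrices with vanishing row and column sums -/

open Matrix in
/-- Adding the all-ones matrix to a matrix with vanishing row and column sums multiplies the
determinant of its grounding at `v` by the square of the size: both are congruent through
`1 + (𝟙 - δ_v) 𝟙ᵀ`, which fixes the matrix and sends `δ_v` to `𝟙`. -/
theorem Matrix.det_add_ones_eq {V : Type*} [Fintype V] [DecidableEq V] (L : Matrix V V ℤ)
    (hrow : L *ᵥ 1 = 0) (hcol : 1 ᵥ* L = 0) (v : V) :
    (L + vecMulVec 1 1).det =
      (Fintype.card V : ℤ) ^ 2 * (L + vecMulVec (Pi.single v 1) (Pi.single v 1)).det := by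
  set δ : V → ℤ := Pi.single v 1 with hδ
  set P : Matrix V V ℤ := 1 + vecMulVec (1 - δ) 1 with hP
  have h1δ : (1 : V → ℤ) ⬝ᵥ δ = 1 := by simp [hδ]
  have hPdet : P.det = Fintype.card V := by
    rw [hP, vecMulVec_eq Unit, det_one_add_replicateCol_mul_replicateRow, dotProduct_sub, h1δ]
    simp
  have hPL : P * L = L := by
    rw [hP, add_mul, one_mul, vecMulVec_mul, hcol]
    simp
  have hLP : L * Pᵀ = L := by
    rw [hP, transpose_add, transpose_one, mul_add, mul_one, transpose_vecMulVec,
      mul_vecMulVec, hrow]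
    simp
  have hPδ : P *ᵥ δ = 1 := by
    rw [hP, add_mulVec, one_mulVec, vecMulVec_mulVec, h1δ]
    simp
  have key : P * (L + vecMulVec δ δ) * Pᵀ = L + vecMulVec 1 1 := by
    rw [mul_add, add_mul, hPL, hLP, mul_vecMulVec, vecMulVec_mul, hPδ, vecMul_transpose, hPδ]
  rw [← key, det_mul, det_mul, det_transpose, hPdet]
  ring

/-- The order of the cokernel of a nonsingular integer matrix. -/
theorem Matrix.card_quotient_range_mulVecLin {V : Type*} [Fintype V] [DecidableEq V]
    (M : Matrix V V ℤ) (hM : M.det ≠ 0) :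
    Nat.card ((V → ℤ) ⧸ LinearMap.range M.mulVecLin) = M.det.natAbs := by
  have hinj : Function.Injective M.mulVecLin := by
    rw [← LinearMap.ker_eq_bot]
    exact Matrix.ker_mulVecLin_eq_bot_iff.2 fun v hv =>
      Matrix.eq_zero_of_mulVec_eq_zero hM hv
  rw [← Submodule.natAbs_det_equiv _ (LinearEquiv.ofInjective _ hinj)]
  congr 1
  rw [← LinearMap.det_toLin' M]
  congr 1

open Matrix in
/-- The matrix-tree relation for the torsion of the cokernel of a matrix with vanishing row and
column sums. Grounding at `v` adds `ℤ δ_v` to the image of `L`; since an element of `ℤ^V` has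
torsion class exactly when its coordinates sum to zero, this kills a complement of the torsion. -/
theorem Matrix.card_torsion_quotient_range {V : Type*} [Fintype V] [DecidableEq V]
    (L : Matrix V V ℤ) (hrow : L *ᵥ 1 = 0) (hcol : 1 ᵥ* L = 0) (v : V)
    (hdet : (L + vecMulVec (Pi.single v 1) (Pi.single v 1)).det ≠ 0) :
    Nat.card (AddCommGroup.torsion ((V → ℤ) ⧸ LinearMap.range L.mulVecLin)) =
      (L + vecMulVec (Pi.single v 1) (Pi.single v 1)).det.natAbs := by
  set δ : V → ℤ := Pi.single v 1 with hδ
  set M := L + vecMulVec δ δ with hM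
  have h1δ : (1 : V → ℤ) ⬝ᵥ δ = 1 := by simp [hδ]
  have hMx (x : V → ℤ) : M *ᵥ x = L *ᵥ x + x v • δ := by
    rw [hM, add_mulVec, vecMulVec_mulVec]
    simp [hδ]
  have hsum (x : V → ℤ) : (1 : V → ℤ) ⬝ᵥ (L *ᵥ x) = 0 := by
    rw [dotProduct_mulVec, hcol, zero_dotProduct]
  have hgrounded (x : V → ℤ) (c : ℤ) : ∃ z, M *ᵥ z = L *ᵥ x + c • δ := by
    refine ⟨x + (c - x v) • 1, ?_⟩
    rw [hMx, mulVec_add, mulVec_smul, hrow]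
    simp
  have hle : LinearMap.range L.mulVecLin ≤ LinearMap.range M.mulVecLin := by
    rintro _ ⟨x, rfl⟩
    obtain ⟨z, hz⟩ := hgrounded x 0
    exact ⟨z, by simpa using hz⟩
  have htors (y : V → ℤ) : (LinearMap.range L.mulVecLin).mkQ y ∈
      AddCommGroup.torsion ((V → ℤ) ⧸ LinearMap.range L.mulVecLin) ↔ 1 ⬝ᵥ y = 0 := by
    constructor
    · intro h
      obtain ⟨n, hn, h⟩ := (isOfFinAddOrder_iff_nsmul_eq_zero).1 h
      rw [← map_nsmul, Submodule.mkQ_apply, Submodule.Quotient.mk_eq_zero] at h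
      obtain ⟨x, hx⟩ := h
      have := hsum x
      rw [← mulVecLin_apply, hx, dotProduct_smul] at this
      simpa [hn.ne'] using this
    · intro h
      obtain ⟨z, hz⟩ : ∃ z, M *ᵥ z = M.det • y :=
        ⟨M.adjugate *ᵥ y, by rw [mulVec_mulVec, mul_adjugate, smul_mulVec, one_mulVec]⟩
      have hzv : z v = 0 := by
        have := congrArg (fun w => (1 : V → ℤ) ⬝ᵥ w) hz
        rw [hMx, dotProduct_add, hsum, dotProduct_smul, dotProduct_smul, h1δ, h] at this
        simpa using this
      refine (isOfFinAddOrder_iff_zsmul_eq_zero).2 ⟨M.det, hdet, ?_⟩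
      rw [← map_zsmul, Submodule.mkQ_apply, Submodule.Quotient.mk_eq_zero]
      exact ⟨z, by rw [mulVecLin_apply, ← hz, hMx, hzv]; simp⟩
  rw [← M.card_quotient_range_mulVecLin hdet]
  let φ := Submodule.factor hle
  have hφ (y : V → ℤ) : φ ((LinearMap.range L.mulVecLin).mkQ y) =
    (LinearMap.range M.mulVecLin).mkQ y := rfl
  refine Nat.card_congr (Equiv.ofBijective
    (fun t : AddCommGroup.torsion ((V → ℤ) ⧸ LinearMap.range L.mulVecLin) => φ t.1) ⟨?_, ?_⟩)
  · intro s t hst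
    have hker : φ (s.1 - t.1) = 0 := by
      rw [map_sub]; exact sub_eq_zero.2 hst
    obtain ⟨y, hy⟩ := Submodule.mkQ_surjective _
      (s.1 - t.1)
    have hy0 : (1 : V → ℤ) ⬝ᵥ y = 0 := (htors y).1 (hy ▸ sub_mem s.2 t.2)
    rw [← hy] at hker
    have hmem : y ∈ LinearMap.range M.mulVecLin := by
      rwa [hφ, Submodule.mkQ_apply, Submodule.Quotient.mk_eq_zero] at hker
    obtain ⟨z, hz⟩ := hmem
    rw [mulVecLin_apply, hMx] at hz
    have hzv : z v = 0 := by
      have := congrArg (fun w => (1 : V → ℤ) ⬝ᵥ w) hz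
      rw [dotProduct_add, hsum, dotProduct_smul, h1δ, hy0] at this
      simpa using this
    have hyL : (LinearMap.range L.mulVecLin).mkQ y = 0 := by
      rw [Submodule.mkQ_apply, Submodule.Quotient.mk_eq_zero]
      exact ⟨z, by rw [mulVecLin_apply, ← hz, hzv]; simp⟩
    exact Subtype.ext (sub_eq_zero.1 (hy ▸ hyL))
  · intro q
    obtain ⟨y, rfl⟩ := Submodule.mkQ_surjective _ q
    refine ⟨⟨(LinearMap.range L.mulVecLin).mkQ (y - (1 ⬝ᵥ y) • δ), (htors _).2 ?_⟩, ?_⟩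
    · rw [dotProduct_sub, dotProduct_smul, h1δ]; simp
    · change φ ((LinearMap.range L.mulVecLin).mkQ _) = _
      rw [hφ, Submodule.mkQ_apply, Submodule.mkQ_apply, Submodule.Quotient.eq]
      obtain ⟨z, hz⟩ := hgrounded 0 (-(1 ⬝ᵥ y))
      exact ⟨z, by rw [mulVecLin_apply, hz]; simp⟩

/-! ### The Laplacian of a Cayley multigraph of a finite abelian group -/

/-- The Laplacian matrix of the Cayley multigraph of a finite abelian group `A` with one generator
`g i` for each `i` and edges from `x` to `x + g i`; loops contribute zero. -/
def cayleyLaplacian {ι A : Type*} [Fintype ι] [AddCommGroup A] [DecidableEq A] (g : ι → A) :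
    Matrix A A ℤ :=
  Matrix.of fun x y => ∑ i, ((if y = x then 2 else 0) - (if y = x + g i then 1 else 0) -
    (if y = x - g i then 1 else 0))

/-- The eigenvalue of the Cayley Laplacian at the character `ψ`. -/
noncomputable def cayleyEigenvalue {ι A : Type*} [Fintype ι] [AddCommGroup A] (g : ι → A)
    (ψ : AddChar A ℂ) : ℝ :=
  ∑ i, (2 - 2 * (ψ (g i)).re)

section Cayley

variable {ι A : Type*} [Fintype ι] [AddCommGroup A] [Fintype A] [DecidableEq A]

open Matrix

theorem cayleyLaplacian_mulVec_one (g : ι → A) : cayleyLaplacian g *ᵥ 1 = 0 := by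
  funext x
  simp only [cayleyLaplacian, mulVec, dotProduct, of_apply, Pi.one_apply, mul_one,
    Pi.zero_apply]
  rw [Finset.sum_comm]
  refine Finset.sum_eq_zero fun i _ => ?_
  simp [Finset.sum_sub_distrib]

/-- The characters diagonalize the Cayley Laplacian, and so does adding the all-ones matrix, which
moves only the eigenvalue of the trivial character. -/
theorem cayleyLaplacian_mulVec_addChar (g : ι → A) (ψ : AddChar A ℂ) :
    (cayleyLaplacian g + vecMulVec 1 1).map (Int.cast : ℤ → ℂ) *ᵥ ψ =
      (if ψ = 0 then (Fintype.card A : ℂ) else (cayleyEigenvalue g ψ : ℂ)) • (ψ : A → ℂ) := by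
  have hneg (a : A) : ψ (-a) = (starRingEnd ℂ) (ψ a) := AddChar.map_neg_eq_conj ψ a
  have hre (a : A) : 2 * ((ψ a).re : ℂ) = ψ a + ψ (-a) := by
    rw [hneg, Complex.add_conj]; push_cast; ring
  have hsum : ∑ y, ψ y = if ψ = 0 then (Fintype.card A : ℂ) else 0 := AddChar.sum_eq_ite ψ
  have hlap (x : A) : ∑ y, ((cayleyLaplacian g x y : ℤ) : ℂ) * ψ y =
      (cayleyEigenvalue g ψ : ℂ) * ψ x := by
    simp only [cayleyLaplacian, of_apply, cayleyEigenvalue]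
    push_cast
    simp only [Finset.sum_mul]
    rw [Finset.sum_comm]
    refine Finset.sum_congr rfl fun i _ => ?_
    simp only [sub_mul, ite_mul, zero_mul, one_mul, Finset.sum_sub_distrib, Finset.sum_ite_eq',
      Finset.mem_univ, if_true, hre, sub_eq_add_neg x, AddChar.map_add_eq_mul]
    ring
  funext x
  simp only [mulVec, dotProduct, map_apply, Matrix.add_apply, vecMulVec_apply, Pi.one_apply, mul_one,
    Int.cast_add, Int.cast_one, add_mul, one_mul, Finset.sum_add_distrib, hlap, hsum,
    Pi.smul_apply, smul_eq_mul]
  split_ifs with h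
  · subst h
    simp [cayleyEigenvalue]
  · rw [add_zero]

theorem det_cayleyLaplacian_add_ones (g : ι → A) :
    ((cayleyLaplacian g + vecMulVec 1 1).det : ℝ) =
      Fintype.card A * ∏ ψ ∈ Finset.univ.erase (0 : AddChar A ℂ), cayleyEigenvalue g ψ := by
  have h : ((cayleyLaplacian g + vecMulVec 1 1).det : ℂ) =
      Fintype.card A * ∏ ψ ∈ Finset.univ.erase (0 : AddChar A ℂ), (cayleyEigenvalue g ψ : ℂ) := by
    set M := (cayleyLaplacian g + vecMulVec 1 1).map (Int.cast : ℤ → ℂ) with hM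
    have hdiag : LinearMap.toMatrix (AddChar.complexBasis A) (AddChar.complexBasis A)
        (Matrix.toLin' M) = diagonal fun ψ : AddChar A ℂ =>
          if ψ = 0 then (Fintype.card A : ℂ) else (cayleyEigenvalue g ψ : ℂ) := by
      ext χ ψ
      rw [LinearMap.toMatrix_apply, AddChar.complexBasis_apply, Matrix.toLin'_apply, hM,
        cayleyLaplacian_mulVec_addChar, map_smul, ← AddChar.complexBasis_apply,
        Module.Basis.repr_self, diagonal_apply]
      simp only [Finsupp.smul_apply, Finsupp.single_apply, smul_eq_mul, mul_ite, mul_one, mul_zero]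
      by_cases hχ : χ = ψ
      · simp [hχ]
      · simp [hχ, Ne.symm hχ]
    have hcast : ((cayleyLaplacian g + vecMulVec 1 1).det : ℂ) = M.det := Int.cast_det _
    rw [hcast, ← LinearMap.det_toLin',
      ← LinearMap.det_toMatrix (AddChar.complexBasis A), hdiag, det_diagonal,
      ← Finset.mul_prod_erase _ _ (Finset.mem_univ (0 : AddChar A ℂ)), if_pos rfl]
    congr 1
    exact Finset.prod_congr rfl fun ψ hψ => if_neg (Finset.ne_of_mem_erase hψ)
  apply Complex.ofReal_injective
  rw [Complex.ofReal_intCast, h]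
  push_cast
  rfl

end Cayley

/-! ### Laplacians of multigraphs and of quotients of the grid -/

namespace Multigraph

open Matrix

variable {V E : Type*} (G : Multigraph V E)

theorem adjacency_symm (i j : V) : G.adjacency i j = G.adjacency j i := by
  by_cases h : i = j
  · rw [h]
  · simp only [adjacency, of_apply, if_neg h, if_neg (Ne.symm h), Sym2.eq_swap (a := i) (b := j)]

variable [Fintype V]

theorem laplacian_apply_ne {i j : V} (hij : i ≠ j) :
    G.laplacian i j = -(Nat.card {e // G.ends e = s(i, j)} : ℤ) := by
  simp [laplacian, adjacency, hij]

theorem laplacian_mulVec_one : G.laplacian *ᵥ 1 = 0 := by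
  classical
  funext i
  simp [laplacian, mulVec, dotProduct, diagonal_apply]

theorem one_vecMul_laplacian : 1 ᵥ* G.laplacian = 0 := by
  classical
  have h : G.laplacianᵀ = G.laplacian := by
    rw [laplacian, transpose_sub, diagonal_transpose]
    congr 1
    · ext i j
      exact G.adjacency_symm j i
  rw [← h, vecMul_transpose, laplacian_mulVec_one]

/-- A form of the matrix-tree theorem: the all-ones matrix replaces the deletion of a vertex. -/
theorem card_sq_mul_complexity [DecidableEq V] [Nonempty V]
    (h : (G.laplacian + vecMulVec 1 1).det ≠ 0) :
    Fintype.card V ^ 2 * G.complexity = (G.laplacian + vecMulVec 1 1).det.natAbs := by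
  let v : V := Classical.arbitrary V
  have key := G.laplacian.det_add_ones_eq G.laplacian_mulVec_one G.one_vecMul_laplacian v
  have hv : (G.laplacian + vecMulVec (Pi.single v 1) (Pi.single v 1)).det ≠ 0 := by
    rintro h0
    exact h (by rw [key, h0, mul_zero])
  rw [complexity, G.laplacian.card_torsion_quotient_range G.laplacian_mulVec_one
    G.one_vecMul_laplacian v hv, key, Int.natAbs_mul, Int.natAbs_pow, Int.natAbs_natCast]

end Multigraph

/-- A square matrix with vanishing row sums is determined by its off-diagonal entries. -/
theorem Matrix.ext_of_mulVec_one {V R : Type*} [Fintype V] [DecidableEq V] [Ring R]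
    {M N : Matrix V V R} (hM : M.mulVec 1 = 0) (hN : N.mulVec 1 = 0)
    (h : ∀ i j, i ≠ j → M i j = N i j) : M = N := by
  ext i j
  by_cases hij : i = j
  · subst hij
    have h1 := congrFun hM i
    have h2 := congrFun hN i
    simp only [mulVec, dotProduct, Pi.one_apply, mul_one, Pi.zero_apply] at h1 h2
    rw [← Finset.add_sum_erase _ _ (Finset.mem_univ i)] at h1 h2
    rw [eq_neg_of_add_eq_zero_left h1, eq_neg_of_add_eq_zero_left h2]
    exact congrArg _ (Finset.sum_congr rfl fun k hk => h i k (Finset.ne_of_mem_erase hk).symm)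
  · exact h i j hij

section Grid

variable {d : ℕ} (Λ : AddSubgroup (Fin d → ℤ))

/-- The image of the `i`-th standard basis vector in `ℤ^d / Λ`. -/
def basisClass (i : Fin d) : (Fin d → ℤ) ⧸ Λ := QuotientAddGroup.mk (Pi.single i 1)

/-- The `Λ`-orbits of the vertices of the grid are the cosets of `Λ`. -/
def vertexOrbitEquiv : AddAction.orbitRel.Quotient Λ (Fin d → ℤ) ≃ (Fin d → ℤ) ⧸ Λ :=
  Quotient.congr (Equiv.refl _) fun x y => by
    change x ∈ AddAction.orbit Λ y ↔ QuotientAddGroup.leftRel Λ x y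
    rw [QuotientAddGroup.leftRel_apply, AddAction.mem_orbit_iff]
    constructor
    · rintro ⟨s, rfl⟩
      change -((s : Fin d → ℤ) + y) + y ∈ Λ
      simp
    · intro h
      refine ⟨⟨x - y, by simpa [sub_eq_add_neg, add_comm] using neg_mem h⟩, ?_⟩
      change x - y + y = x
      simp

/-- The `Λ`-orbits of the edges of the grid are the pairs of a coset and a direction. -/
noncomputable def edgeOrbitEquiv :
    AddAction.orbitRel.Quotient Λ (GridEdge d) ≃ ((Fin d → ℤ) ⧸ Λ) × Fin d :=
  Equiv.ofBijective
    (Quotient.lift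
      (fun e : GridEdge d => ((QuotientAddGroup.mk e.base : (Fin d → ℤ) ⧸ Λ), e.dir)) (by
      rintro _ e ⟨s, rfl⟩
      refine Prod.ext ?_ rfl
      change (QuotientAddGroup.mk ((s : Fin d → ℤ) + e.base) : (Fin d → ℤ) ⧸ Λ) = _
      rw [QuotientAddGroup.eq]
      simp)) (by
    constructor
    · intro p q
      induction p using Quotient.inductionOn with
      | h e =>
      induction q using Quotient.inductionOn with
      | h f =>
      intro h
      have h1 : (QuotientAddGroup.mk e.base : (Fin d → ℤ) ⧸ Λ) = QuotientAddGroup.mk f.base :=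
        congrArg Prod.fst h
      have h2 : e.dir = f.dir := congrArg Prod.snd h
      rw [QuotientAddGroup.eq] at h1
      refine Quotient.sound ⟨⟨e.base - f.base,
        by simpa [sub_eq_add_neg, add_comm] using neg_mem h1⟩, ?_⟩
      exact GridEdge.ext (sub_add_cancel e.base f.base) h2.symm
    · rintro ⟨a, i⟩
      obtain ⟨s, rfl⟩ := QuotientAddGroup.mk_surjective a
      exact ⟨Quotient.mk _ ⟨s, i⟩, rfl⟩)

theorem map_ends_quotient (q : AddAction.orbitRel.Quotient Λ (GridEdge d)) :
    (((gridGraph d).quotient Λ).ends q).map (vertexOrbitEquiv Λ) =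
      s((edgeOrbitEquiv Λ q).1, (edgeOrbitEquiv Λ q).1 + basisClass Λ (edgeOrbitEquiv Λ q).2) := by
  induction q using Quotient.inductionOn with
  | h e => rfl

theorem laplacian_quotient_gridGraph [Fintype (AddAction.orbitRel.Quotient Λ (Fin d → ℤ))]
    [Fintype ((Fin d → ℤ) ⧸ Λ)] [DecidableEq ((Fin d → ℤ) ⧸ Λ)] :
    ((gridGraph d).quotient Λ).laplacian =
      (cayleyLaplacian (basisClass Λ)).submatrix (vertexOrbitEquiv Λ) (vertexOrbitEquiv Λ) := by
  classical
  -- Comparing off the diagonal suffices, so loops need no separate treatment.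
  refine Matrix.ext_of_mulVec_one (Multigraph.laplacian_mulVec_one _) ?_ ?_
  · have := Matrix.submatrix_mulVec_equiv (cayleyLaplacian (basisClass Λ)) 1
      (vertexOrbitEquiv Λ) (vertexOrbitEquiv Λ)
    have h1 : (1 : AddAction.orbitRel.Quotient Λ (Fin d → ℤ) → ℤ) ∘ (vertexOrbitEquiv Λ).symm = 1 :=
      rfl
    rw [h1, cayleyLaplacian_mulVec_one] at this
    exact this
  intro p q hpq
  set x := vertexOrbitEquiv Λ p with hx
  set y := vertexOrbitEquiv Λ q with hy
  have hxy : y ≠ x := fun h => hpq ((vertexOrbitEquiv Λ).injective h.symm)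
  -- Each direction contributes the edges with base point `x` and those with base point `y`.
  have hcount : Nat.card {e // ((gridGraph d).quotient Λ).ends e = s(p, q)} =
      ∑ i, ((if y = x + basisClass Λ i then 1 else 0) +
        (if y = x - basisClass Λ i then 1 else 0)) := by
    have e1 : {e // ((gridGraph d).quotient Λ).ends e = s(p, q)} ≃
        {z : ((Fin d → ℤ) ⧸ Λ) × Fin d // s(z.1, z.1 + basisClass Λ z.2) = s(x, y)} :=
      (edgeOrbitEquiv Λ).subtypeEquiv fun e => by
        rw [← map_ends_quotient, hx, hy, ← Sym2.map_mk]
        exact (Sym2.map.injective (vertexOrbitEquiv Λ).injective).eq_iff.symm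
    rw [Nat.card_congr e1, Nat.card_eq_fintype_card, Fintype.card_subtype, Finset.card_filter,
      Fintype.sum_prod_type_right]
    refine Finset.sum_congr rfl fun i _ => ?_
    have hsplit (a : (Fin d → ℤ) ⧸ Λ) : (if s(a, a + basisClass Λ i) = s(x, y) then 1 else 0) =
        (if a = x then (if y = x + basisClass Λ i then 1 else 0) else 0) +
        (if a = y then (if y = x - basisClass Λ i then 1 else 0) else 0) := by
      simp only [Sym2.eq_iff]
      by_cases hax : a = x
      · subst hax
        simp [hxy.symm, eq_comm]
      · by_cases hay : a = y
        · subst hay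
          simp [hxy, eq_sub_iff_add_eq]
        · simp [hax, hay]
    simp only [hsplit, Finset.sum_add_distrib, Finset.sum_ite_eq', Finset.mem_univ, if_true]
  rw [Multigraph.laplacian_apply_ne _ hpq, hcount,
    Matrix.submatrix_apply, cayleyLaplacian, Matrix.of_apply]
  push_cast
  rw [← Finset.sum_neg_distrib]
  refine Finset.sum_congr rfl fun i _ => ?_
  rw [if_neg hxy]
  ring

end Grid

/-! ### Means over the dual group and Riemann sums of the sine -/

section DualMean

variable {A : Type*} [AddCommGroup A] [Finite A]

/-- The mean of `F` over the dual of a finite abelian group `A`, which has as many elements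
as `A`. -/
noncomputable def dualMean (F : AddChar A ℂ → ℝ) : ℝ := (∑ ψ, F ψ) / Nat.card A

theorem dualMean_mono {F G : AddChar A ℂ → ℝ} (h : ∀ ψ, F ψ ≤ G ψ) : dualMean F ≤ dualMean G :=
  div_le_div_of_nonneg_right (Finset.sum_le_sum fun ψ _ => h ψ) (Nat.cast_nonneg _)

theorem dualMean_add (F G : AddChar A ℂ → ℝ) :
    dualMean (fun ψ => F ψ + G ψ) = dualMean F + dualMean G := by
  simp only [dualMean, Finset.sum_add_distrib, add_div]

theorem dualMean_const_mul (c : ℝ) (F : AddChar A ℂ → ℝ) :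
    dualMean (fun ψ => c * F ψ) = c * dualMean F := by
  simp only [dualMean, ← Finset.mul_sum, mul_div_assoc]

theorem dualMean_sum {ι : Type*} (s : Finset ι) (F : ι → AddChar A ℂ → ℝ) :
    dualMean (fun ψ => ∑ i ∈ s, F i ψ) = ∑ i ∈ s, dualMean (F i) := by
  simp only [dualMean]
  rw [Finset.sum_comm, Finset.sum_div]

open Classical in
theorem dualMean_re_apply (a : A) :
    dualMean (fun ψ : AddChar A ℂ => (ψ a).re) = if a = 0 then 1 else 0 := by
  cases nonempty_fintype A
  have h := congrArg Complex.re (AddChar.sum_apply_eq_ite a)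
  rw [Complex.re_sum] at h
  rw [dualMean, h, Nat.card_eq_fintype_card]
  split_ifs <;> simp

theorem dualMean_const (c : ℝ) : dualMean (fun _ : AddChar A ℂ => c) = c := by
  have h := dualMean_re_apply (0 : A)
  simp only [AddChar.map_zero_eq_one, Complex.one_re, if_true] at h
  simpa [h] using dualMean_const_mul (A := A) c fun _ => 1

open Classical in
/-- The values of the characters at `a` are equidistributed among the roots of unity of order
`addOrderOf a`. -/
theorem dualMean_indicator_apply_eq (a : A) {z : ℂ} (hz : z ^ addOrderOf a = 1) :
    dualMean (fun ψ => if ψ a = z then 1 else 0) = 1 / (addOrderOf a : ℝ) := by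
  cases nonempty_fintype A
  have hm : addOrderOf a ≠ 0 := (addOrderOf_pos a).ne'
  set m := addOrderOf a with hmdef
  have hz0 : z ≠ 0 := by
    rintro rfl
    rw [zero_pow hm] at hz
    exact zero_ne_one hz
  -- The indicator of `ψ a = z` is a normalized geometric sum of `ψ a / z`.
  have hgeom (ψ : AddChar A ℂ) : ((if ψ a = z then 1 else 0 : ℝ) : ℂ) =
      (∑ l ∈ Finset.range m, z⁻¹ ^ l * ψ (l • a)) / m := by
    have hpow : (z⁻¹ * ψ a) ^ m = 1 := by
      rw [mul_pow, inv_pow, hz, ← AddChar.map_nsmul_eq_pow, hmdef, addOrderOf_nsmul_eq_zero]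
      simp
    have hsum : ∑ l ∈ Finset.range m, z⁻¹ ^ l * ψ (l • a) =
        ∑ l ∈ Finset.range m, (z⁻¹ * ψ a) ^ l :=
      Finset.sum_congr rfl fun l _ => by rw [mul_pow, AddChar.map_nsmul_eq_pow]
    rw [hsum]
    split_ifs with h
    · rw [h, inv_mul_cancel₀ hz0]
      have : (m : ℂ) ≠ 0 := Nat.cast_ne_zero.2 hm
      simp [this]
    · have h1 : z⁻¹ * ψ a ≠ 1 := fun h1 => h (by rwa [inv_mul_eq_one₀ hz0, eq_comm] at h1)
      rw [geom_sum_eq h1, hpow]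
      simp
  have hcount : ((∑ ψ : AddChar A ℂ, if ψ a = z then 1 else 0 : ℝ) : ℂ) =
      (Fintype.card A : ℂ) / m := by
    rw [Complex.ofReal_sum, Finset.sum_congr rfl fun ψ _ => hgeom ψ, ← Finset.sum_div,
      Finset.sum_comm]
    congr 1
    rw [Finset.sum_eq_single_of_mem 0 (Finset.mem_range.2 (Nat.pos_of_ne_zero hm))]
    · simp
    · intro l hl hl0
      rw [← Finset.mul_sum, AddChar.sum_apply_eq_ite, if_neg, mul_zero]
      exact fun h => hl0 (Nat.eq_zero_of_dvd_of_lt (addOrderOf_dvd_of_nsmul_eq_zero h)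
        (Finset.mem_range.1 hl))
  have hreal : (∑ ψ : AddChar A ℂ, if ψ a = z then 1 else 0 : ℝ) = (Fintype.card A : ℝ) / m := by
    apply Complex.ofReal_injective
    rw [hcount]
    push_cast
    rfl
  have hA : (Fintype.card A : ℝ) ≠ 0 := Nat.cast_ne_zero.2 Fintype.card_ne_zero
  rw [dualMean, hreal, Nat.card_eq_fintype_card]
  field_simp

/-- By equidistribution, a mean over the dual of a function of `re (ψ a)` is a Riemann sum. -/
theorem dualMean_comp_apply (a : A) (F : ℝ → ℝ) :
    dualMean (fun ψ => F (ψ a).re) =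
      (∑ j ∈ Finset.range (addOrderOf a), F (Real.cos (2 * (Real.pi * j / addOrderOf a)))) /
        addOrderOf a := by
  classical
  set m := addOrderOf a with hm
  have hm0 : m ≠ 0 := (addOrderOf_pos a).ne'
  set ζ := Complex.exp (2 * Real.pi * Complex.I / m) with hζdef
  have hζ : IsPrimitiveRoot ζ m := Complex.isPrimitiveRoot_exp m hm0
  have hre (j : ℕ) : (ζ ^ j).re = Real.cos (2 * (Real.pi * j / m)) := by
    rw [hζdef, ← Complex.exp_nat_mul]
    have : (j : ℂ) * (2 * Real.pi * Complex.I / m) =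
        ((2 * (Real.pi * j / m) : ℝ) : ℂ) * Complex.I := by
      push_cast; ring
    rw [this, Complex.exp_ofReal_mul_I_re]
  have hexpand (ψ : AddChar A ℂ) : F (ψ a).re =
      ∑ j ∈ Finset.range m, F (ζ ^ j).re * if ψ a = ζ ^ j then 1 else 0 := by
    have hroot : ψ a ^ m = 1 := by
      rw [← AddChar.map_nsmul_eq_pow, hm, addOrderOf_nsmul_eq_zero, AddChar.map_zero_eq_one]
    have : NeZero m := ⟨hm0⟩
    obtain ⟨j, hj, hjψ⟩ := hζ.eq_pow_of_pow_eq_one hroot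
    rw [Finset.sum_eq_single_of_mem j (Finset.mem_range.2 hj), if_pos hjψ.symm, hjψ, mul_one]
    intro l hl hlj
    rw [if_neg, mul_zero]
    rw [← hjψ]
    exact fun h => hlj (hζ.pow_inj (Finset.mem_range.1 hl) hj h.symm)
  simp only [hexpand]
  rw [dualMean_sum, Finset.sum_div]
  refine Finset.sum_congr rfl fun j _ => ?_
  rw [dualMean_const_mul, dualMean_indicator_apply_eq, hre, mul_one_div]
  rw [← pow_mul, mul_comm, pow_mul, hζ.pow_eq_one, one_pow]

end DualMean

section SineSum

theorem sum_one_div_sqrt_le (n : ℕ) :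
    ∑ j ∈ Finset.range n, 1 / √((j : ℝ) + 1) ≤ 2 * √n := by
  induction n with
  | zero => simp
  | succ n ih =>
    rw [Finset.sum_range_succ]
    have h0 : (0 : ℝ) < √((n : ℝ) + 1) := Real.sqrt_pos.2 (by positivity)
    have h1 : √((n : ℝ) + 1) ^ 2 = n + 1 := Real.sq_sqrt (by positivity)
    have h2 : √(n : ℝ) ^ 2 = n := Real.sq_sqrt (by positivity)
    have h3 : 1 / √((n : ℝ) + 1) ≤ 2 * (√((n : ℝ) + 1) - √n) := by
      rw [div_le_iff₀ h0]
      nlinarith [sq_nonneg (√((n : ℝ) + 1) - √n)]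
    push_cast
    linarith

theorem rpow_neg_quarter_le_sqrt {x t : ℝ} (ht : 0 < t) (h : t ^ 2 ≤ x) :
    x ^ (-(1 / 4) : ℝ) ≤ √(1 / t) := by
  calc x ^ (-(1 / 4) : ℝ) ≤ (t ^ 2) ^ (-(1 / 4) : ℝ) :=
        Real.rpow_le_rpow_of_nonpos (by positivity) h (by norm_num)
    _ = √(1 / t) := by
        rw [← Real.rpow_natCast, ← Real.rpow_mul ht.le, Real.sqrt_eq_rpow, one_div t,
          Real.inv_rpow ht.le, ← Real.rpow_neg ht.le]
        norm_num

/-- Near zero `sin² t` is comparable to `t²`, so its power `-1/4` has bounded Riemann sums; the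
term `j = 0` is zero by convention. -/
theorem sum_sin_sq_rpow_le (m : ℕ) :
    ∑ j ∈ Finset.range m, (Real.sin (Real.pi * j / m) ^ 2) ^ (-(1 / 4) : ℝ) ≤ 4 * m := by
  rcases m with _ | n
  · simp
  set m : ℝ := ((n + 1 : ℕ) : ℝ) with hm
  have hm0 : 0 < m := by positivity
  have hterm (j : ℕ) (hj : j < n) :
      (Real.sin (Real.pi * (j + 1 : ℕ) / m) ^ 2) ^ (-(1 / 4) : ℝ) ≤
        √m * (1 / √((j : ℝ) + 1)) + √m * (1 / √(((n - 1 - j : ℕ) : ℝ) + 1)) := by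
    have hcast : (((n - 1 - j : ℕ) : ℝ) + 1) = m - (j + 1) := by
      rw [hm, Nat.cast_sub (by omega), Nat.cast_sub (by omega)]
      push_cast; ring
    have hjm : (j : ℝ) + 1 < m := by rw [hm]; exact_mod_cast Nat.succ_lt_succ hj
    have hpos : (0 : ℝ) < (j : ℝ) + 1 := by positivity
    have hsin {t : ℝ} (h0 : 0 < t) (h1 : t ≤ 1 / 2) : t ≤ Real.sin (Real.pi * t) := by
      have := Real.mul_le_sin (x := Real.pi * t) (by positivity) (by nlinarith [Real.pi_pos])
      have h2 : 2 / Real.pi * (Real.pi * t) = 2 * t := by field_simp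
      linarith
    have hconv {s : ℝ} (hs : 0 < s) : √(1 / (s / m)) = √m * (1 / √s) := by
      rw [one_div_div, Real.sqrt_div hm0.le, mul_one_div]
    rw [hcast]
    push_cast
    -- The nearer of the two zeros `0` and `π` of the sine decides which summand is used.
    rcases le_total (((j : ℝ) + 1) / m) (1 / 2) with h | h
    · have hs := hsin (div_pos hpos hm0) h
      have := rpow_neg_quarter_le_sqrt (div_pos hpos hm0)
        (pow_le_pow_left₀ (div_pos hpos hm0).le hs 2)
      rw [hconv hpos, ← mul_div_assoc] at this
      exact this.trans (le_add_of_nonneg_right (by positivity))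
    · have hpos' : 0 < m - (j + 1) := by linarith
      have h' : (m - (j + 1)) / m ≤ 1 / 2 := by
        rw [sub_div, div_self hm0.ne']; linarith
      have hs := hsin (div_pos hpos' hm0) h'
      have hrefl : Real.pi * ((m - (j + 1)) / m) = Real.pi - Real.pi * (j + 1) / m := by
        field_simp
      rw [hrefl, Real.sin_pi_sub] at hs
      have := rpow_neg_quarter_le_sqrt (div_pos hpos' hm0)
        (pow_le_pow_left₀ (div_pos hpos' hm0).le hs 2)
      rw [hconv hpos'] at this
      exact this.trans (le_add_of_nonneg_left (by positivity))
  rw [Finset.sum_range_succ']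
  have h0 : (Real.sin (Real.pi * (0 : ℕ) / m) ^ 2) ^ (-(1 / 4) : ℝ) = 0 := by
    simp
  rw [h0, add_zero]
  refine (Finset.sum_le_sum fun j hj => hterm j (Finset.mem_range.1 hj)).trans ?_
  rw [Finset.sum_add_distrib, ← Finset.mul_sum, ← Finset.mul_sum,
    Finset.sum_range_reflect (fun j : ℕ => 1 / √((j : ℝ) + 1)) n]
  have hn : √(n : ℝ) ≤ √m := Real.sqrt_le_sqrt (by rw [hm]; push_cast; linarith)
  have hsq : √m * √m = m := Real.mul_self_sqrt hm0.le
  have := sum_one_div_sqrt_le n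
  nlinarith [Real.sqrt_nonneg m]

end SineSum

/-! ### The Fourier coefficients of the lazy random walk -/

section LazySymbol

variable {ι A : Type*} [AddCommGroup A]

/-- The Fourier coefficient at `ψ` of the step distribution on `A` that stays put with
probability `1/2` and moves by `a` and by `-a` with probability `1/4` each. -/
noncomputable def lazyFactor (ψ : AddChar A ℂ) (a : A) : ℝ := (1 + (ψ a).re) / 2

variable [Fintype ι]

/-- The Fourier coefficient at `ψ` of the lazy simple random walk with generators `g i`. -/
noncomputable def lazySymbol (g : ι → A) (ψ : AddChar A ℂ) : ℝ :=
  (∑ i, lazyFactor ψ (g i)) / Fintype.card ι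

theorem cayleyEigenvalue_eq [Nonempty ι] (g : ι → A) (ψ : AddChar A ℂ) :
    cayleyEigenvalue g ψ = 4 * Fintype.card ι * (1 - lazySymbol g ψ) := by
  have hι : (Fintype.card ι : ℝ) ≠ 0 := Nat.cast_ne_zero.2 Fintype.card_ne_zero
  have h : cayleyEigenvalue g ψ = ∑ i, (4 - 4 * lazyFactor ψ (g i)) :=
    Finset.sum_congr rfl fun i _ => by rw [lazyFactor]; ring
  rw [h, Finset.sum_sub_distrib, ← Finset.mul_sum, lazySymbol]
  simp
  field_simp

variable [Finite A]

theorem lazyFactor_nonneg (ψ : AddChar A ℂ) (a : A) : 0 ≤ lazyFactor ψ a := by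
  have h := (abs_le.1 ((Complex.abs_re_le_norm (ψ a)).trans_eq (ψ.norm_apply a))).1
  rw [lazyFactor]; linarith

theorem lazyFactor_le_one (ψ : AddChar A ℂ) (a : A) : lazyFactor ψ a ≤ 1 := by
  have h := (abs_le.1 ((Complex.abs_re_le_norm (ψ a)).trans_eq (ψ.norm_apply a))).2
  rw [lazyFactor]; linarith

theorem lazyFactor_lt_one {ψ : AddChar A ℂ} {a : A} (h : ψ a ≠ 1) : lazyFactor ψ a < 1 := by
  refine lt_of_le_of_ne (lazyFactor_le_one ψ a) fun h1 => h ?_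
  have hre : (ψ a).re = 1 := by rw [lazyFactor] at h1; linarith
  have hn : ‖ψ a‖ = 1 := ψ.norm_apply a
  have him : (ψ a).im = 0 := by
    have := Complex.sq_norm (ψ a)
    rw [hn, Complex.normSq_apply, hre] at this
    nlinarith
  exact Complex.ext hre him

theorem lazySymbol_nonneg (g : ι → A) (ψ : AddChar A ℂ) : 0 ≤ lazySymbol g ψ :=
  div_nonneg (Finset.sum_nonneg fun i _ => lazyFactor_nonneg ψ (g i)) (Nat.cast_nonneg _)

theorem lazySymbol_le_one [Nonempty ι] (g : ι → A) (ψ : AddChar A ℂ) : lazySymbol g ψ ≤ 1 := by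
  have hι : (0 : ℝ) < Fintype.card ι := Nat.cast_pos.2 Fintype.card_pos
  rw [lazySymbol, div_le_one hι]
  calc ∑ i, lazyFactor ψ (g i) ≤ ∑ _ : ι, (1 : ℝ) :=
        Finset.sum_le_sum fun i _ => lazyFactor_le_one ψ (g i)
    _ = Fintype.card ι := by simp

theorem one_sub_lazyFactor_div_le [Nonempty ι] (g : ι → A) (ψ : AddChar A ℂ) (i : ι) :
    (1 - lazyFactor ψ (g i)) / Fintype.card ι ≤ 1 - lazySymbol g ψ := by
  have hι : (0 : ℝ) < Fintype.card ι := Nat.cast_pos.2 Fintype.card_pos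
  have hsum : 1 - lazySymbol g ψ = (∑ j, (1 - lazyFactor ψ (g j))) / Fintype.card ι := by
    rw [Finset.sum_sub_distrib, lazySymbol, sub_div]
    simp [hι.ne']
  rw [hsum]
  exact div_le_div_of_nonneg_right (Finset.single_le_sum
    (f := fun j => 1 - lazyFactor ψ (g j))
    (fun j _ => sub_nonneg.2 (lazyFactor_le_one ψ (g j))) (Finset.mem_univ i)) hι.le

theorem lazySymbol_lt_one [Nonempty ι] {g : ι → A} {ψ : AddChar A ℂ} {i : ι} (h : ψ (g i) ≠ 1) :
    lazySymbol g ψ < 1 := by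
  have hι : (0 : ℝ) < Fintype.card ι := Nat.cast_pos.2 Fintype.card_pos
  have h1 := one_sub_lazyFactor_div_le g ψ i
  have h2 : 0 < (1 - lazyFactor ψ (g i)) / Fintype.card ι :=
    div_pos (sub_pos.2 (lazyFactor_lt_one h)) hι
  linarith

omit [Fintype ι] in
theorem dualMean_one_sub_lazyFactor_rpow_le (a : A) :
    dualMean (fun ψ => (1 - lazyFactor ψ a) ^ (-(1 / 4) : ℝ)) ≤ 4 := by
  have hm : (0 : ℝ) < addOrderOf a := Nat.cast_pos.2 (addOrderOf_pos a)
  have h := dualMean_comp_apply a fun x => (1 - (1 + x) / 2) ^ (-(1 / 4) : ℝ)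
  simp only [lazyFactor]
  rw [h, div_le_iff₀ hm]
  refine le_trans (Finset.sum_le_sum fun j _ => le_of_eq ?_) (sum_sin_sq_rpow_le _)
  congr 1
  rw [Real.cos_two_mul, Real.sin_sq]
  ring

/-- With `y = n (1 - c)`, this is `exp (-y) ≤ y ^ (-1/4)`. -/
theorem pow_le_rpow_neg_quarter {c : ℝ} (h0 : 0 ≤ c) (h1 : c < 1) {n : ℕ} (hn : n ≠ 0) :
    c ^ n ≤ (n * (1 - c)) ^ (-(1 / 4) : ℝ) := by
  have hy : 0 < n * (1 - c) := mul_pos (by positivity) (sub_pos.2 h1)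
  set y := n * (1 - c) with hydef
  have hexp : c ^ n ≤ Real.exp (-y) := by
    calc c ^ n ≤ Real.exp (-(1 - c)) ^ n :=
          pow_le_pow_left₀ h0 (by linarith [Real.add_one_le_exp (-(1 - c))]) n
      _ = Real.exp (-y) := by rw [← Real.exp_nat_mul, hydef]; congr 1; ring
  refine hexp.trans ?_
  rw [Real.rpow_neg hy.le, Real.exp_neg]
  refine inv_anti₀ (Real.rpow_pos_of_pos hy _) ?_
  have h := Real.add_one_le_exp y
  rcases le_total y 1 with hy1 | hy1
  · linarith [Real.rpow_le_one hy.le hy1 (by norm_num : (0 : ℝ) ≤ 1 / 4)]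
  · have := Real.rpow_le_rpow_of_exponent_le hy1 (by norm_num : (1 / 4 : ℝ) ≤ 1)
    rw [Real.rpow_one] at this
    linarith

omit [Fintype ι] in
theorem dualMean_lazyFactor_pow_le (a : A) {n : ℕ} (hn : n ≠ 0) :
    dualMean (fun ψ => lazyFactor ψ a ^ n) ≤
      1 / (addOrderOf a : ℝ) + 4 * (n : ℝ) ^ (-(1 / 4) : ℝ) := by
  classical
  have hbound (ψ : AddChar A ℂ) : lazyFactor ψ a ^ n ≤ (if ψ a = 1 then 1 else 0) +
      (n : ℝ) ^ (-(1 / 4) : ℝ) * (1 - lazyFactor ψ a) ^ (-(1 / 4) : ℝ) := by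
    have hnn : 0 ≤ (n : ℝ) ^ (-(1 / 4) : ℝ) * (1 - lazyFactor ψ a) ^ (-(1 / 4) : ℝ) :=
      mul_nonneg (Real.rpow_nonneg (Nat.cast_nonneg n) _)
        (Real.rpow_nonneg (sub_nonneg.2 (lazyFactor_le_one ψ a)) _)
    split_ifs with h
    · have := pow_le_one₀ (n := n) (lazyFactor_nonneg ψ a) (lazyFactor_le_one ψ a)
      linarith
    · rw [zero_add, ← Real.mul_rpow (Nat.cast_nonneg n) (sub_nonneg.2 (lazyFactor_le_one ψ a))]
      exact pow_le_rpow_neg_quarter (lazyFactor_nonneg ψ a) (lazyFactor_lt_one h) hn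
  refine (dualMean_mono hbound).trans ?_
  rw [dualMean_add, dualMean_indicator_apply_eq a (one_pow _), dualMean_const_mul]
  have := mul_le_mul_of_nonneg_left (dualMean_one_sub_lazyFactor_rpow_le a)
    (Real.rpow_nonneg (Nat.cast_nonneg n) (-(1 / 4)))
  linarith

theorem dualMean_lazySymbol_pow_le [Nonempty ι] (g : ι → A) {R : ℝ} (hR : 0 < R)
    (hg : ∀ i, R ≤ addOrderOf (g i)) {n : ℕ} (hn : n ≠ 0) :
    dualMean (fun ψ => lazySymbol g ψ ^ n) ≤ 1 / R + 4 * (n : ℝ) ^ (-(1 / 4) : ℝ) := by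
  have hι : (0 : ℝ) < Fintype.card ι := Nat.cast_pos.2 Fintype.card_pos
  -- Convexity of `x ↦ x ^ n` reduces to a single generator.
  have hconv (ψ : AddChar A ℂ) : lazySymbol g ψ ^ n ≤
      (Fintype.card ι : ℝ)⁻¹ * ∑ i, lazyFactor ψ (g i) ^ n := by
    obtain ⟨k, rfl⟩ := Nat.exists_eq_succ_of_ne_zero hn
    have h := pow_sum_div_card_le_sum_pow (s := Finset.univ) (f := fun i => lazyFactor ψ (g i))
      (fun i _ => lazyFactor_nonneg ψ (g i)) k
    rw [Finset.card_univ, div_le_iff₀ (by positivity)] at h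
    rw [lazySymbol, div_pow, div_le_iff₀ (by positivity)]
    refine h.trans (le_of_eq ?_)
    rw [Nat.succ_eq_add_one, pow_succ (Fintype.card ι : ℝ)]
    field_simp
  refine (dualMean_mono hconv).trans ?_
  rw [dualMean_const_mul, dualMean_sum, inv_mul_le_iff₀ hι]
  calc ∑ i, dualMean (fun ψ => lazyFactor ψ (g i) ^ n)
      ≤ ∑ _ : ι, (1 / R + 4 * (n : ℝ) ^ (-(1 / 4) : ℝ)) :=
        Finset.sum_le_sum fun i _ => (dualMean_lazyFactor_pow_le (g i) hn).trans
          (add_le_add_left (one_div_le_one_div_of_le hR (hg i)) _)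
    _ = _ := by rw [Finset.sum_const, Finset.card_univ, nsmul_eq_mul]

/-- A bound on the moments without the trivial character that depends on `g` only through the number
of generators. Each nontrivial character is charged to a generator on which it is nontrivial; the
terms for the other generators, possibly `0 ^ (-1/4) = 0`, are nonnegative. -/
theorem sum_nontrivial_lazySymbol_pow_le [Nonempty ι] {g : ι → A}
    (hgen : ∀ ψ : AddChar A ℂ, ψ ≠ 0 → ∃ i, ψ (g i) ≠ 1) {n : ℕ} (hn : n ≠ 0) :
    (∑ ψ ∈ Finset.univ.erase (0 : AddChar A ℂ), lazySymbol g ψ ^ n) / Nat.card A ≤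
      4 * Fintype.card ι * ((n : ℝ) / Fintype.card ι) ^ (-(1 / 4) : ℝ) := by
  have hι : (0 : ℝ) < Fintype.card ι := Nat.cast_pos.2 Fintype.card_pos
  set r := ((n : ℝ) / Fintype.card ι) ^ (-(1 / 4) : ℝ) with hr
  have hr0 : 0 ≤ r := Real.rpow_nonneg (by positivity) _
  have hterm0 (ψ : AddChar A ℂ) (i : ι) : 0 ≤ r * (1 - lazyFactor ψ (g i)) ^ (-(1 / 4) : ℝ) :=
    mul_nonneg hr0 (Real.rpow_nonneg (sub_nonneg.2 (lazyFactor_le_one ψ (g i))) _)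
  have hpoint (ψ : AddChar A ℂ) (hψ : ψ ≠ 0) : lazySymbol g ψ ^ n ≤
      ∑ i, r * (1 - lazyFactor ψ (g i)) ^ (-(1 / 4) : ℝ) := by
    obtain ⟨i, hi⟩ := hgen ψ hψ
    have hpos := sub_pos.2 (lazyFactor_lt_one hi)
    have hn0 : (0 : ℝ) < n := Nat.cast_pos.2 (Nat.pos_of_ne_zero hn)
    calc lazySymbol g ψ ^ n ≤ (n * (1 - lazySymbol g ψ)) ^ (-(1 / 4) : ℝ) :=
          pow_le_rpow_neg_quarter (lazySymbol_nonneg g ψ) (lazySymbol_lt_one hi) hn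
      _ ≤ (n * ((1 - lazyFactor ψ (g i)) / Fintype.card ι)) ^ (-(1 / 4) : ℝ) :=
          Real.rpow_le_rpow_of_nonpos (by positivity)
            (mul_le_mul_of_nonneg_left (one_sub_lazyFactor_div_le g ψ i) hn0.le) (by norm_num)
      _ = r * (1 - lazyFactor ψ (g i)) ^ (-(1 / 4) : ℝ) := by
          rw [hr, ← Real.mul_rpow (by positivity) hpos.le]
          congr 1
          ring
      _ ≤ _ := Finset.single_le_sum (fun j _ => hterm0 ψ j) (Finset.mem_univ i)
  calc (∑ ψ ∈ Finset.univ.erase (0 : AddChar A ℂ), lazySymbol g ψ ^ n) / Nat.card A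
      ≤ dualMean (fun ψ : AddChar A ℂ => ∑ i, r * (1 - lazyFactor ψ (g i)) ^ (-(1 / 4) : ℝ)) := by
        refine div_le_div_of_nonneg_right ?_ (Nat.cast_nonneg _)
        refine (Finset.sum_le_sum fun ψ hψ => hpoint ψ (Finset.ne_of_mem_erase hψ)).trans ?_
        exact Finset.sum_le_sum_of_subset_of_nonneg (Finset.erase_subset _ _)
          fun ψ _ _ => Finset.sum_nonneg fun i _ => hterm0 ψ i
    _ ≤ ∑ _ : ι, r * 4 := by
        rw [dualMean_sum]
        refine Finset.sum_le_sum fun i _ => ?_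
        rw [dualMean_const_mul]
        exact mul_le_mul_of_nonneg_left (dualMean_one_sub_lazyFactor_rpow_le (g i)) hr0
    _ = _ := by simp; ring

end LazySymbol

/-! ### Moments and the logarithmic series -/

section Moments

/-- The steps of the lazy walk with generators `g i`, each of them equally likely. -/
def lazyStep {ι A : Type*} [AddCommGroup A] (g : ι → A) (p : ι × Fin 4) : A :=
  ![0, 0, g p.1, -g p.1] p.2

/-- The probability that the lazy simple random walk on `ℤ^d` is at its starting point after `n`
steps. -/
noncomputable def lazyReturnProb (d n : ℕ) : ℝ :=
  Nat.card {w : Fin n → Fin d × Fin 4 //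
    ∑ j, lazyStep (fun i => (Pi.single i 1 : Fin d → ℤ)) (w j) = 0} / (4 * d : ℝ) ^ n

variable {ι A : Type*} [AddCommGroup A] [Fintype ι] [Finite A]

theorem lazySymbol_eq_sum_lazyStep (g : ι → A) (ψ : AddChar A ℂ) :
    (lazySymbol g ψ : ℂ) = (∑ p, ψ (lazyStep g p)) / (4 * Fintype.card ι) := by
  have hneg (a : A) : ψ (-a) = (starRingEnd ℂ) (ψ a) := AddChar.map_neg_eq_conj ψ a
  have hre (a : A) : 2 * ((ψ a).re : ℂ) = ψ a + ψ (-a) := by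
    rw [hneg, Complex.add_conj]; push_cast; ring
  have hsum : ∑ p, ψ (lazyStep g p) = ∑ i, 4 * (lazyFactor ψ (g i) : ℂ) := by
    rw [Fintype.sum_prod_type]
    refine Finset.sum_congr rfl fun i _ => ?_
    rw [Fin.sum_univ_four, lazyFactor]
    push_cast
    linear_combination (norm := (simp [lazyStep]; try ring)) - hre (g i)
  rw [hsum, ← Finset.mul_sum, lazySymbol]
  push_cast
  rw [mul_div_mul_left _ _ (by norm_num)]

/-- The moments of the symbol are the return probabilities of the walk on `A`. -/
theorem dualMean_lazySymbol_pow (g : ι → A) (n : ℕ) :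
    dualMean (fun ψ => lazySymbol g ψ ^ n) =
      Nat.card {w : Fin n → ι × Fin 4 // ∑ j, lazyStep g (w j) = 0} /
        (4 * Fintype.card ι : ℝ) ^ n := by
  classical
  cases nonempty_fintype A
  have hpow (ψ : AddChar A ℂ) : ((lazySymbol g ψ ^ n : ℝ) : ℂ) =
      (∑ w : Fin n → ι × Fin 4, ψ (∑ j, lazyStep g (w j))) / (4 * Fintype.card ι) ^ n := by
    rw [Complex.ofReal_pow, lazySymbol_eq_sum_lazyStep, div_pow, Finset.sum_pow',
      Fintype.piFinset_univ]
    congr 1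
    refine Finset.sum_congr rfl fun w _ => ?_
    exact (map_prod ψ.toMonoidHom (fun j => Multiplicative.ofAdd (lazyStep g (w j))) _).symm
  have hsum : ((∑ ψ : AddChar A ℂ, lazySymbol g ψ ^ n : ℝ) : ℂ) =
      Nat.card {w : Fin n → ι × Fin 4 // ∑ j, lazyStep g (w j) = 0} * Fintype.card A /
        (4 * Fintype.card ι) ^ n := by
    rw [Complex.ofReal_sum, Finset.sum_congr rfl fun ψ _ => hpow ψ, ← Finset.sum_div,
      Finset.sum_comm]
    congr 1
    simp only [AddChar.sum_apply_eq_ite]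
    rw [← Finset.sum_filter, Finset.sum_const, nsmul_eq_mul, Nat.card_eq_fintype_card,
      Fintype.card_subtype]
  have hreal : (∑ ψ : AddChar A ℂ, lazySymbol g ψ ^ n : ℝ) =
      Nat.card {w : Fin n → ι × Fin 4 // ∑ j, lazyStep g (w j) = 0} * Fintype.card A /
        (4 * Fintype.card ι) ^ n := by
    apply Complex.ofReal_injective
    rw [hsum]
    push_cast
    rfl
  have hA : (Fintype.card A : ℝ) ≠ 0 := Nat.cast_ne_zero.2 Fintype.card_ne_zero
  rw [dualMean, hreal, Nat.card_eq_fintype_card (α := A), div_right_comm, mul_div_cancel_right₀ _ hA]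

theorem dualMean_lazySymbol_sub_half [Nonempty ι] {g : ι → A} (h0 : ∀ i, g i ≠ 0) :
    dualMean (fun ψ => lazySymbol g ψ - 1 / 2) = 0 := by
  have hι : (Fintype.card ι : ℝ) ≠ 0 := Nat.cast_ne_zero.2 Fintype.card_ne_zero
  have h (ψ : AddChar A ℂ) : lazySymbol g ψ - 1 / 2 =
      (2 * Fintype.card ι : ℝ)⁻¹ * ∑ i, (ψ (g i)).re := by
    simp only [lazySymbol, lazyFactor]
    rw [← Finset.sum_div, Finset.sum_add_distrib]
    simp
    field_simp
    ring
  simp only [h]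
  rw [dualMean_const_mul, dualMean_sum]
  simp [dualMean_re_apply, h0]

/-- The real parts of distinct generators are orthogonal on the dual, with variance `1/2`. -/
theorem dualMean_lazySymbol_sub_half_sq [Nonempty ι] {g : ι → A}
    (hadd : ∀ i j, g i + g j ≠ 0) (hinj : Function.Injective g) :
    dualMean (fun ψ => (lazySymbol g ψ - 1 / 2) ^ 2) = 1 / (8 * Fintype.card ι) := by
  classical
  have hι : (Fintype.card ι : ℝ) ≠ 0 := Nat.cast_ne_zero.2 Fintype.card_ne_zero
  have hmul (ψ : AddChar A ℂ) (a b : A) :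
      (ψ a).re * (ψ b).re = 1 / 2 * ((ψ (a + b)).re + (ψ (a - b)).re) := by
    have hneg : ψ (-b) = (starRingEnd ℂ) (ψ b) := AddChar.map_neg_eq_conj ψ b
    rw [sub_eq_add_neg, AddChar.map_add_eq_mul, AddChar.map_add_eq_mul, hneg]
    simp
    ring
  have h (ψ : AddChar A ℂ) : (lazySymbol g ψ - 1 / 2) ^ 2 =
      (8 * Fintype.card ι ^ 2 : ℝ)⁻¹ *
        ∑ i, ∑ j, ((ψ (g i + g j)).re + (ψ (g i - g j)).re) := by
    have h1 : lazySymbol g ψ - 1 / 2 = (2 * Fintype.card ι : ℝ)⁻¹ * ∑ i, (ψ (g i)).re := by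
      simp only [lazySymbol, lazyFactor]
      rw [← Finset.sum_div, Finset.sum_add_distrib]
      simp
      field_simp
      ring
    have h2 : (∑ i, (ψ (g i)).re) ^ 2 =
        1 / 2 * ∑ i, ∑ j, ((ψ (g i + g j)).re + (ψ (g i - g j)).re) := by
      rw [sq, Finset.sum_mul_sum]
      simp only [hmul, Finset.mul_sum]
    rw [h1, mul_pow, h2]
    ring
  have hmean (i j : ι) : dualMean (fun ψ : AddChar A ℂ =>
      (ψ (g i + g j)).re + (ψ (g i - g j)).re) = if i = j then 1 else 0 := by
    rw [dualMean_add, dualMean_re_apply, dualMean_re_apply, if_neg (hadd i j), zero_add]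
    simp only [sub_eq_zero, hinj.eq_iff]
  simp only [h]
  rw [dualMean_const_mul, dualMean_sum]
  simp only [dualMean_sum, hmean]
  simp
  field_simp

/-- The tangent line of `b ↦ b ^ n` at `1/2`. -/
theorem half_pow_add_le_pow {b : ℝ} (h0 : 0 ≤ b) (n : ℕ) :
    (1 / 2) ^ n + 2 * n * (1 / 2) ^ n * (b - 1 / 2) ≤ b ^ n := by
  induction n with
  | zero => simp
  | succ n ih =>
    have hc : (0 : ℝ) ≤ (1 / 2) ^ n := by positivity
    have h := mul_le_mul_of_nonneg_left ih h0
    have h2 : 0 ≤ 2 * n * (1 / 2 : ℝ) ^ n * (b - 1 / 2) ^ 2 := by positivity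
    rw [pow_succ b, pow_succ (1 / 2 : ℝ)]
    push_cast
    nlinarith

/-- A second-order Taylor bound for `b ↦ b ^ n` at `1/2`. -/
theorem pow_le_half_pow_add {b : ℝ} (h0 : 0 ≤ b) (h1 : b ≤ 1) (n : ℕ) :
    b ^ n ≤ (1 / 2) ^ n + 2 * n * (1 / 2) ^ n * (b - 1 / 2) + n ^ 2 * (b - 1 / 2) ^ 2 := by
  induction n with
  | zero => simp
  | succ n ih =>
    have hc : (1 / 2 : ℝ) ^ n ≤ 1 := pow_le_one₀ (by norm_num) (by norm_num)
    have h := mul_le_mul_of_nonneg_left ih h0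
    have h2 : 0 ≤ 2 * n * (1 - (1 / 2 : ℝ) ^ n) * (b - 1 / 2) ^ 2 :=
      mul_nonneg (mul_nonneg (by positivity) (sub_nonneg.2 hc)) (sq_nonneg _)
    have h3 : 0 ≤ (1 - b) * (n ^ 2 * (b - 1 / 2) ^ 2) :=
      mul_nonneg (sub_nonneg.2 h1) (by positivity)
    have h4 := sq_nonneg (b - 1 / 2)
    rw [pow_succ b, pow_succ (1 / 2 : ℝ)]
    push_cast
    nlinarith

theorem half_pow_le_dualMean_lazySymbol_pow [Nonempty ι] {g : ι → A} (hg : ∀ i, g i ≠ 0) (n : ℕ) :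
    (1 / 2) ^ n ≤ dualMean (fun ψ => lazySymbol g ψ ^ n) := by
  have h := dualMean_mono fun ψ : AddChar A ℂ => half_pow_add_le_pow (lazySymbol_nonneg g ψ) n
  rw [dualMean_add (fun _ => (1 / 2 : ℝ) ^ n), dualMean_const_mul, dualMean_const,
    dualMean_lazySymbol_sub_half hg] at h
  simpa using h

theorem dualMean_lazySymbol_pow_le_half_pow_add [Nonempty ι] {g : ι → A}
    (hadd : ∀ i j, g i + g j ≠ 0) (hinj : Function.Injective g) (n : ℕ) :
    dualMean (fun ψ => lazySymbol g ψ ^ n) ≤ (1 / 2) ^ n + n ^ 2 * (1 / (8 * Fintype.card ι)) := by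
  have hg (i : ι) : g i ≠ 0 := fun h => hadd i i (by rw [h, add_zero])
  have h := dualMean_mono fun ψ : AddChar A ℂ =>
    pow_le_half_pow_add (lazySymbol_nonneg g ψ) (lazySymbol_le_one g ψ) n
  rw [dualMean_add (fun ψ => (1 / 2 : ℝ) ^ n + 2 * n * (1 / 2) ^ n * (lazySymbol g ψ - 1 / 2)),
    dualMean_add (fun _ => (1 / 2 : ℝ) ^ n), dualMean_const_mul, dualMean_const_mul,
    dualMean_const, dualMean_lazySymbol_sub_half hg, dualMean_lazySymbol_sub_half_sq hadd hinj] at h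
  simpa using h

/-- The logarithm of the product of the nonzero eigenvalues, expanded into moments through
`-log (1 - b) = ∑ b ^ (n + 1) / (n + 1)`. -/
theorem sum_log_cayleyEigenvalue_div_card [Nonempty ι] {g : ι → A}
    (hgen : ∀ ψ : AddChar A ℂ, ψ ≠ 0 → ∃ i, ψ (g i) ≠ 1) :
    (∑ ψ ∈ Finset.univ.erase (0 : AddChar A ℂ), Real.log (cayleyEigenvalue g ψ)) / Nat.card A =
      (1 - 1 / Nat.card A) * Real.log (4 * Fintype.card ι) -
        ∑' n : ℕ, (∑ ψ ∈ Finset.univ.erase (0 : AddChar A ℂ), lazySymbol g ψ ^ (n + 1)) /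
          Nat.card A / (n + 1) := by
  cases nonempty_fintype A
  have hι : (0 : ℝ) < Fintype.card ι := Nat.cast_pos.2 Fintype.card_pos
  have hA : (Nat.card A : ℝ) ≠ 0 := Nat.cast_ne_zero.2 Nat.card_pos.ne'
  have hlt {ψ : AddChar A ℂ} (hψ : ψ ∈ Finset.univ.erase 0) : lazySymbol g ψ < 1 := by
    obtain ⟨i, hi⟩ := hgen ψ (Finset.ne_of_mem_erase hψ)
    exact lazySymbol_lt_one hi
  have hlog : ∑ ψ ∈ Finset.univ.erase (0 : AddChar A ℂ), Real.log (cayleyEigenvalue g ψ) =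
      ∑ ψ ∈ Finset.univ.erase (0 : AddChar A ℂ),
        (Real.log (4 * Fintype.card ι) + Real.log (1 - lazySymbol g ψ)) :=
    Finset.sum_congr rfl fun ψ hψ => by
      rw [cayleyEigenvalue_eq, Real.log_mul (by positivity) (sub_pos.2 (hlt hψ)).ne']
  have hseries : HasSum (fun n : ℕ => (∑ ψ ∈ Finset.univ.erase (0 : AddChar A ℂ),
      lazySymbol g ψ ^ (n + 1)) / Nat.card A / (n + 1))
      ((∑ ψ ∈ Finset.univ.erase (0 : AddChar A ℂ), -Real.log (1 - lazySymbol g ψ)) /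
        Nat.card A) := by
    have h := (hasSum_sum fun (ψ : AddChar A ℂ) (hψ : ψ ∈ Finset.univ.erase 0) =>
      Real.hasSum_pow_div_log_of_abs_lt_one (x := lazySymbol g ψ)
        (by rw [abs_of_nonneg (lazySymbol_nonneg g ψ)]; exact hlt hψ)).div_const (Nat.card A : ℝ)
    refine h.congr_fun ?_
    intro n
    rw [← Finset.sum_div, div_right_comm]
  have hcard : ((Finset.univ.erase (0 : AddChar A ℂ)).card : ℝ) = Nat.card A - 1 := by
    rw [Finset.card_erase_of_mem (Finset.mem_univ _), Finset.card_univ, AddChar.card_eq,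
      Nat.cast_sub Fintype.card_pos, Nat.card_eq_fintype_card, Nat.cast_one]
  rw [hseries.tsum_eq, hlog, Finset.sum_add_distrib, Finset.sum_const, nsmul_eq_mul, hcard,
    Finset.sum_neg_distrib]
  field_simp
  ring

end Moments

/-! ### The limit of large subgroups and of large dimension -/

section MinLength

variable {d : ℕ}

theorem minLength_le {Λ : AddSubgroup (Fin d → ℤ)} {s : Fin d → ℤ} (hs : s ∈ Λ) (h0 : s ≠ 0) :
    minLength Λ ≤ √(∑ i, (s i : ℝ) ^ 2) := by
  refine csInf_le ⟨0, ?_⟩ ⟨s, hs, h0, rfl⟩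
  rintro _ ⟨t, _, _, rfl⟩
  exact Real.sqrt_nonneg _

theorem eq_zero_of_mem_of_lt_minLength {Λ : AddSubgroup (Fin d → ℤ)} {s : Fin d → ℤ} (hs : s ∈ Λ)
    {n : ℕ} (hn : ∀ i, |s i| ≤ n) (hlt : √(d * n ^ 2) < minLength Λ) : s = 0 := by
  by_contra h0
  refine (hlt.trans_le (minLength_le hs h0)).not_ge (Real.sqrt_le_sqrt ?_)
  calc ∑ i, (s i : ℝ) ^ 2 ≤ ∑ _ : Fin d, (n : ℝ) ^ 2 := Finset.sum_le_sum fun i _ => by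
        rw [sq_le_sq, abs_of_nonneg (Nat.cast_nonneg (α := ℝ) n)]
        exact_mod_cast hn i
    _ = d * n ^ 2 := by simp

theorem eventually_lt_minLength (R : ℝ) :
    ∀ᶠ Λ in minLengthAtTop d, R < minLength Λ.1 :=
  tendsto_comap.eventually_gt_atTop R

/-- The subgroups `n ℤ^d` witness that `⟨Λ⟩` is unbounded. -/
theorem minLengthAtTop_neBot (hd : 1 ≤ d) : (minLengthAtTop d).NeBot := by
  rw [minLengthAtTop, comap_neBot_iff]
  intro t ht
  obtain ⟨R, hR⟩ := mem_atTop_sets.1 ht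
  obtain ⟨n, hn⟩ := exists_nat_ge R
  have : NeZero (n + 1) := ⟨n.succ_ne_zero⟩
  let Λ : AddSubgroup (Fin d → ℤ) := ((Int.castAddHom (ZMod (n + 1))).compLeft (Fin d)).ker
  have hmem (s : Fin d → ℤ) : s ∈ Λ ↔ ∀ i, ((n + 1 : ℕ) : ℤ) ∣ s i := by
    rw [AddMonoidHom.mem_ker, funext_iff]
    exact forall_congr' fun i => ZMod.intCast_zmod_eq_zero_iff_dvd (s i) (n + 1)
  refine ⟨⟨Λ, AddSubgroup.finiteIndex_ker _⟩, hR _ ?_⟩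
  refine hn.trans (le_csInf ⟨_, Pi.single ⟨0, hd⟩ ((n + 1 : ℕ) : ℤ), ?_, ?_, rfl⟩ ?_)
  · rw [hmem]
    intro i
    by_cases hi : i = ⟨0, hd⟩
    · subst hi; simp
    · simp [Pi.single_eq_of_ne hi]
  · rw [Ne, Pi.single_eq_zero_iff]
    exact_mod_cast n.succ_ne_zero
  · rintro _ ⟨s, hs, h0, rfl⟩
    obtain ⟨i, hi⟩ := Function.ne_iff.1 h0
    have h1 : ((n + 1 : ℕ) : ℤ) ≤ |s i| :=
      Int.le_of_dvd (abs_pos.2 hi) ((dvd_abs _ _).2 ((hmem s).1 hs i))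
    have h2 : (n : ℝ) ≤ |(s i : ℝ)| := by
      have : (n : ℤ) ≤ |s i| := by push_cast at h1; linarith
      exact_mod_cast this
    calc (n : ℝ) ≤ √((s i : ℝ) ^ 2) := by rwa [Real.sqrt_sq_eq_abs]
      _ ≤ _ := Real.sqrt_le_sqrt (Finset.single_le_sum (f := fun j => (s j : ℝ) ^ 2)
        (fun j _ => sq_nonneg _) (Finset.mem_univ i))

instance finite_quotient_finiteIndexSubgroup (Λ : FiniteIndexSubgroup d) :
    Finite ((Fin d → ℤ) ⧸ Λ.1) :=
  haveI := Λ.2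
  AddSubgroup.finite_quotient_of_finiteIndex

theorem minLength_le_addOrderOf_basisClass (Λ : FiniteIndexSubgroup d) (i : Fin d) :
    minLength Λ.1 ≤ addOrderOf (basisClass Λ.1 i) := by
  set m := addOrderOf (basisClass Λ.1 i) with hm
  have hm0 : m ≠ 0 := (addOrderOf_pos (basisClass Λ.1 i)).ne'
  have hmem : Pi.single i (m : ℤ) ∈ Λ.1 := by
    rw [← QuotientAddGroup.eq_zero_iff]
    have h := addOrderOf_nsmul_eq_zero (basisClass Λ.1 i)
    rw [← hm, basisClass, ← QuotientAddGroup.mk_nsmul, ← Pi.single_smul] at h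
    simpa using h
  refine (minLength_le hmem ?_).trans (le_of_eq ?_)
  · rw [Ne, Pi.single_eq_zero_iff]
    exact_mod_cast hm0
  · rw [Finset.sum_eq_single i]
    · simp
    · intro j _ hj
      simp [Pi.single_eq_of_ne hj]
    · simp

theorem minLength_le_card_quotient (hd : 1 ≤ d) (Λ : FiniteIndexSubgroup d) :
    minLength Λ.1 ≤ Nat.card ((Fin d → ℤ) ⧸ Λ.1) :=
  (minLength_le_addOrderOf_basisClass Λ ⟨0, hd⟩).trans (Nat.cast_le.2 (addOrderOf_le_card))

theorem tendsto_card_quotient (hd : 1 ≤ d) :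
    Tendsto (fun Λ : FiniteIndexSubgroup d => (Nat.card ((Fin d → ℤ) ⧸ Λ.1) : ℝ))
      (minLengthAtTop d) atTop :=
  tendsto_atTop_mono (minLength_le_card_quotient hd) tendsto_comap

theorem exists_basisClass_ne_one (Λ : FiniteIndexSubgroup d)
    (ψ : AddChar ((Fin d → ℤ) ⧸ Λ.1) ℂ) (hψ : ψ ≠ 0) : ∃ i, ψ (basisClass Λ.1 i) ≠ 1 := by
  by_contra! h
  refine hψ (AddChar.eq_zero_iff.2 fun x => ?_)
  obtain ⟨s, rfl⟩ := QuotientAddGroup.mk_surjective x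
  have key : ψ.toAddMonoidHom.comp (QuotientAddGroup.mk' Λ.1) = 0 := by
    refine AddMonoidHom.functions_ext' _ _ _ fun i => AddMonoidHom.ext_int ?_
    exact h i
  exact DFunLike.congr_fun key s

theorem abs_lazyStep_single_le (p : Fin d × Fin 4) (i : Fin d) :
    |lazyStep (fun i => (Pi.single i 1 : Fin d → ℤ)) p i| ≤ 1 := by
  obtain ⟨j, k⟩ := p
  have h : |(Pi.single j 1 : Fin d → ℤ) i| ≤ 1 := by
    rw [Pi.single_apply]
    split_ifs <;> simp
  fin_cases k
  · simp [lazyStep]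
  · simp [lazyStep]
  · simpa [lazyStep] using h
  · simpa [lazyStep] using h

/-- A closed walk of `n` steps in `ℤ^d / Λ` lifts to a closed walk in `ℤ^d` once `⟨Λ⟩` is large. -/
theorem eventually_dualMean_eq_lazyReturnProb (n : ℕ) :
    ∀ᶠ Λ in minLengthAtTop d,
      dualMean (fun ψ => lazySymbol (basisClass Λ.1) ψ ^ n) = lazyReturnProb d n := by
  filter_upwards [eventually_lt_minLength (d := d) √(d * n ^ 2)] with Λ hΛ
  rw [dualMean_lazySymbol_pow, lazyReturnProb, Fintype.card_fin]
  congr 2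
  refine Nat.card_congr (Equiv.subtypeEquivRight fun w => ?_)
  have hstep (p : Fin d × Fin 4) : lazyStep (basisClass Λ.1) p =
      QuotientAddGroup.mk' Λ.1 (lazyStep (fun i => (Pi.single i 1 : Fin d → ℤ)) p) := by
    obtain ⟨j, k⟩ := p
    fin_cases k <;> simp [lazyStep, basisClass]
  simp only [hstep]
  rw [← map_sum, QuotientAddGroup.mk'_apply, QuotientAddGroup.eq_zero_iff]
  refine ⟨fun h => eq_zero_of_mem_of_lt_minLength h (fun i => ?_) hΛ, fun h => h ▸ Λ.1.zero_mem⟩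
  rw [Finset.sum_apply]
  refine (Finset.abs_sum_le_sum_abs _ _).trans ?_
  calc ∑ j, |lazyStep (fun i => (Pi.single i 1 : Fin d → ℤ)) (w j) i| ≤ ∑ _ : Fin n, (1 : ℤ) :=
        Finset.sum_le_sum fun j _ => abs_lazyStep_single_le (w j) i
    _ = n := by simp

end MinLength

section ReturnProbability

variable {d : ℕ}

theorem half_pow_le_lazyReturnProb (hd : 1 ≤ d) (n : ℕ) : (1 / 2) ^ n ≤ lazyReturnProb d n := by
  have := minLengthAtTop_neBot hd
  have : Nonempty (Fin d) := ⟨⟨0, hd⟩⟩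
  obtain ⟨Λ, h1, h2⟩ := ((eventually_dualMean_eq_lazyReturnProb (d := d) n).and
    (eventually_lt_minLength 1)).exists
  rw [← h1]
  refine half_pow_le_dualMean_lazySymbol_pow (fun i h => ?_) n
  have := minLength_le_addOrderOf_basisClass Λ i
  rw [h, addOrderOf_zero, Nat.cast_one] at this
  linarith

theorem lazyReturnProb_le_half_pow_add (hd : 1 ≤ d) (n : ℕ) :
    lazyReturnProb d n ≤ (1 / 2) ^ n + n ^ 2 * (1 / (8 * d)) := by
  have := minLengthAtTop_neBot hd
  have : Nonempty (Fin d) := ⟨⟨0, hd⟩⟩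
  obtain ⟨Λ, h1, h2⟩ := ((eventually_dualMean_eq_lazyReturnProb (d := d) n).and
    (eventually_lt_minLength √(d * (2 : ℕ) ^ 2))).exists
  have hsingle (i k : Fin d) : |(Pi.single i 1 : Fin d → ℤ) k| ≤ 1 := by
    rw [Pi.single_apply]
    split_ifs <;> simp
  have h := dualMean_lazySymbol_pow_le_half_pow_add (g := basisClass Λ.1) ?_ ?_ n
  · rwa [h1, Fintype.card_fin] at h
  · intro i j hij
    rw [basisClass, basisClass, ← QuotientAddGroup.mk_add, QuotientAddGroup.eq_zero_iff] at hij
    have h0 := congrFun (eq_zero_of_mem_of_lt_minLength hij (fun k =>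
      (abs_add_le _ _).trans (add_le_add (hsingle i k) (hsingle j k))) h2) i
    have hj : 0 ≤ (Pi.single j 1 : Fin d → ℤ) i := by
      rw [Pi.single_apply]
      split_ifs <;> simp
    simp only [Pi.add_apply, Pi.single_eq_same, Pi.zero_apply] at h0
    linarith
  · intro i j hij
    rw [basisClass, basisClass, ← sub_eq_zero, ← QuotientAddGroup.mk_sub,
      QuotientAddGroup.eq_zero_iff] at hij
    have h0 := congrFun (eq_zero_of_mem_of_lt_minLength hij (fun k =>
      (abs_sub _ _).trans (add_le_add (hsingle i k) (hsingle j k))) h2) i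
    by_contra hne
    simp [Pi.single_eq_of_ne hne] at h0

/-- The decay in `n` is uniform in the dimension. -/
theorem lazyReturnProb_le_rpow (hd : 1 ≤ d) {n : ℕ} (hn : n ≠ 0) :
    lazyReturnProb d n ≤ 4 * (n : ℝ) ^ (-(1 / 4) : ℝ) := by
  have := minLengthAtTop_neBot hd
  have : Nonempty (Fin d) := ⟨⟨0, hd⟩⟩
  refine le_of_forall_pos_le_add fun ε hε => ?_
  obtain ⟨Λ, h1, h2⟩ := ((eventually_dualMean_eq_lazyReturnProb (d := d) n).and
    (eventually_lt_minLength (1 / ε))).exists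
  have h := dualMean_lazySymbol_pow_le (basisClass Λ.1) (one_div_pos.2 hε)
    (fun i => h2.le.trans (minLength_le_addOrderOf_basisClass Λ i)) hn
  rw [h1, one_div_one_div] at h
  linarith

theorem summable_rpow_neg_quarter_div :
    Summable fun n : ℕ => ((n : ℝ) + 1) ^ (-(1 / 4) : ℝ) / (n + 1) := by
  have h := (summable_nat_add_iff 1).2 (Real.summable_nat_rpow.2 (by norm_num : (-(5 / 4) : ℝ) < -1))
  refine h.congr fun n => ?_
  have hn : (0 : ℝ) < (n : ℝ) + 1 := by positivity
  rw [Nat.cast_add_one, ← Real.rpow_sub_one hn.ne']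
  norm_num

theorem summable_lazyReturnProb_div (hd : 1 ≤ d) :
    Summable fun n : ℕ => lazyReturnProb d (n + 1) / (n + 1) := by
  refine Summable.of_nonneg_of_le (fun n => ?_) (fun n => ?_)
    (summable_rpow_neg_quarter_div.mul_left 4)
  · exact div_nonneg (le_trans (by positivity) (half_pow_le_lazyReturnProb hd (n + 1)))
      (by positivity)
  · rw [← mul_div_assoc]
    have := lazyReturnProb_le_rpow hd n.succ_ne_zero
    push_cast at this
    exact div_le_div_of_nonneg_right this (by positivity)

theorem hasSum_half_pow_div : HasSum (fun n : ℕ => (1 / 2 : ℝ) ^ (n + 1) / (n + 1)) (Real.log 2) := by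
  have h := Real.hasSum_pow_div_log_of_abs_lt_one (x := 1 / 2) (by norm_num [abs_of_pos])
  have h2 : -Real.log (1 - 1 / 2) = Real.log 2 := by
    rw [← Real.log_inv]; norm_num
  rwa [h2] at h

theorem log_two_le_tsum_lazyReturnProb (hd : 1 ≤ d) :
    Real.log 2 ≤ ∑' n : ℕ, lazyReturnProb d (n + 1) / (n + 1) := by
  rw [← hasSum_half_pow_div.tsum_eq]
  exact hasSum_half_pow_div.summable.tsum_le_tsum (fun n =>
    div_le_div_of_nonneg_right (half_pow_le_lazyReturnProb hd (n + 1)) (by positivity))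
    (summable_lazyReturnProb_div hd)

theorem tendsto_lazyReturnProb (n : ℕ) :
    Tendsto (fun d => lazyReturnProb d n) atTop (𝓝 ((1 / 2) ^ n)) := by
  have hlim : Tendsto (fun d : ℕ => (1 / 2 : ℝ) ^ n + n ^ 2 * (1 / (8 * d))) atTop
      (𝓝 ((1 / 2 : ℝ) ^ n + (n : ℝ) ^ 2 * 0)) := by
    refine tendsto_const_nhds.add (Tendsto.const_mul _ ?_)
    simp only [one_div, mul_inv]
    simpa using (tendsto_inv_atTop_nhds_zero_nat (𝕜 := ℝ)).const_mul (8⁻¹ : ℝ)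
  rw [mul_zero, add_zero] at hlim
  refine tendsto_of_tendsto_of_tendsto_of_le_of_le' tendsto_const_nhds hlim ?_ ?_
  · filter_upwards [eventually_ge_atTop 1] with d hd using half_pow_le_lazyReturnProb hd n
  · filter_upwards [eventually_ge_atTop 1] with d hd using lazyReturnProb_le_half_pow_add hd n

theorem tendsto_tsum_lazyReturnProb :
    Tendsto (fun d => ∑' n : ℕ, lazyReturnProb d (n + 1) / (n + 1)) atTop (𝓝 (Real.log 2)) := by
  rw [← hasSum_half_pow_div.tsum_eq]
  refine tendsto_tsum_of_dominated_convergence (summable_rpow_neg_quarter_div.mul_left 4)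
    (fun n => (tendsto_lazyReturnProb (n + 1)).div_const _) ?_
  filter_upwards [eventually_ge_atTop 1] with d hd n
  rw [Real.norm_of_nonneg (div_nonneg (le_trans (by positivity)
    (half_pow_le_lazyReturnProb hd (n + 1))) (by positivity)), ← mul_div_assoc]
  have := lazyReturnProb_le_rpow hd n.succ_ne_zero
  push_cast at this
  exact div_le_div_of_nonneg_right this (by positivity)

end ReturnProbability

section GrowthRate

variable {d : ℕ}

theorem logComplexityDensity_gridGraph (hd : 1 ≤ d) (Λ : FiniteIndexSubgroup d) :
    (gridGraph d).logComplexityDensity Λ =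
      (1 - 1 / (Nat.card ((Fin d → ℤ) ⧸ Λ.1) : ℝ)) * Real.log (4 * d) -
        (∑' n : ℕ, (∑ ψ ∈ Finset.univ.erase (0 : AddChar ((Fin d → ℤ) ⧸ Λ.1) ℂ),
          lazySymbol (basisClass Λ.1) ψ ^ (n + 1)) / Nat.card ((Fin d → ℤ) ⧸ Λ.1) / (n + 1)) -
        Real.log (Nat.card ((Fin d → ℤ) ⧸ Λ.1)) / Nat.card ((Fin d → ℤ) ⧸ Λ.1) := by
  classical
  have := Λ.2
  have := (gridGraph d).finite_quotient_vertex Λ.1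
  let _ := Fintype.ofFinite (AddAction.orbitRel.Quotient Λ.1 (Fin d → ℤ))
  cases nonempty_fintype ((Fin d → ℤ) ⧸ Λ.1)
  have : Nonempty (Fin d) := ⟨⟨0, hd⟩⟩
  have : Nonempty (AddAction.orbitRel.Quotient Λ.1 (Fin d → ℤ)) := ⟨Quotient.mk _ 0⟩
  have hdpos : (0 : ℝ) < d := Nat.cast_pos.2 hd
  set N := Nat.card ((Fin d → ℤ) ⧸ Λ.1) with hN
  have hN0 : (N : ℝ) ≠ 0 := Nat.cast_ne_zero.2 Nat.card_pos.ne'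
  have hpos {ψ : AddChar ((Fin d → ℤ) ⧸ Λ.1) ℂ} (hψ : ψ ∈ Finset.univ.erase 0) :
      0 < cayleyEigenvalue (basisClass Λ.1) ψ := by
    obtain ⟨i, hi⟩ := exists_basisClass_ne_one Λ ψ (Finset.ne_of_mem_erase hψ)
    rw [cayleyEigenvalue_eq, Fintype.card_fin]
    exact mul_pos (by positivity) (sub_pos.2 (lazySymbol_lt_one hi))
  have hprod : 0 < ∏ ψ ∈ Finset.univ.erase (0 : AddChar ((Fin d → ℤ) ⧸ Λ.1) ℂ),
      cayleyEigenvalue (basisClass Λ.1) ψ := Finset.prod_pos fun ψ hψ => hpos hψ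
  have hdet : ((((gridGraph d).quotient Λ.1).laplacian + Matrix.vecMulVec 1 1).det : ℝ) =
      N * ∏ ψ ∈ Finset.univ.erase (0 : AddChar ((Fin d → ℤ) ⧸ Λ.1) ℂ),
        cayleyEigenvalue (basisClass Λ.1) ψ := by
    rw [hN, Nat.card_eq_fintype_card, ← det_cayleyLaplacian_add_ones,
      ← Matrix.det_submatrix_equiv_self (vertexOrbitEquiv Λ.1), laplacian_quotient_gridGraph]
    rfl
  have hdet0 : (((gridGraph d).quotient Λ.1).laplacian + Matrix.vecMulVec 1 1).det ≠ 0 := by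
    intro h
    rw [h, Int.cast_zero] at hdet
    exact (mul_ne_zero hN0 hprod.ne') hdet.symm
  have hcard : Fintype.card (AddAction.orbitRel.Quotient Λ.1 (Fin d → ℤ)) = N := by
    rw [hN, Nat.card_eq_fintype_card]
    exact Fintype.card_congr (vertexOrbitEquiv Λ.1)
  have hκ : (N : ℝ) ^ 2 * ((gridGraph d).quotientComplexity Λ.1 : ℝ) =
      N * ∏ ψ ∈ Finset.univ.erase (0 : AddChar ((Fin d → ℤ) ⧸ Λ.1) ℂ),
        cayleyEigenvalue (basisClass Λ.1) ψ := by
    have h := ((gridGraph d).quotient Λ.1).card_sq_mul_complexity hdet0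
    rw [hcard] at h
    have h' : ((N ^ 2 * ((gridGraph d).quotient Λ.1).complexity : ℕ) : ℝ) =
        |((((gridGraph d).quotient Λ.1).laplacian + Matrix.vecMulVec 1 1).det : ℝ)| := by
      rw [h, Nat.cast_natAbs, Int.cast_abs]
    rw [hdet, abs_of_nonneg (by positivity)] at h'
    push_cast at h'
    exact h'
  have hκ' : ((gridGraph d).quotientComplexity Λ.1 : ℝ) =
      (∏ ψ ∈ Finset.univ.erase (0 : AddChar ((Fin d → ℤ) ⧸ Λ.1) ℂ),
        cayleyEigenvalue (basisClass Λ.1) ψ) / N := by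
    rw [eq_div_iff hN0]
    apply mul_left_cancel₀ hN0
    linear_combination hκ
  have hmain := sum_log_cayleyEigenvalue_div_card (exists_basisClass_ne_one Λ)
  rw [Fintype.card_fin, ← hN] at hmain
  have hindex : Λ.1.index = N := rfl
  rw [← hmain, PeriodicGraph.logComplexityDensity, hindex, hκ', Real.log_div hprod.ne' hN0,
    Real.log_prod fun ψ hψ => (hpos hψ).ne']
  ring

/-- Tannery's theorem applied to the logarithmic series, dominated through
`sum_nontrivial_lazySymbol_pow_le`. -/
theorem tendsto_logComplexityDensity_gridGraph (hd : 1 ≤ d) :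
    Tendsto (gridGraph d).logComplexityDensity (minLengthAtTop d)
      (𝓝 (Real.log (4 * d) - ∑' n : ℕ, lazyReturnProb d (n + 1) / (n + 1))) := by
  have : Nonempty (Fin d) := ⟨⟨0, hd⟩⟩
  have hdpos : (0 : ℝ) < d := Nat.cast_pos.2 hd
  have hN := tendsto_card_quotient hd
  have hinv : Tendsto (fun Λ : FiniteIndexSubgroup d =>
      1 / (Nat.card ((Fin d → ℤ) ⧸ Λ.1) : ℝ)) (minLengthAtTop d) (𝓝 0) := by
    simp only [one_div]
    exact hN.inv_tendsto_atTop
  have hlog : Tendsto (fun Λ : FiniteIndexSubgroup d =>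
      Real.log (Nat.card ((Fin d → ℤ) ⧸ Λ.1)) / (Nat.card ((Fin d → ℤ) ⧸ Λ.1) : ℝ))
      (minLengthAtTop d) (𝓝 0) :=
    Real.isLittleO_log_id_atTop.tendsto_div_nhds_zero.comp hN
  have hmoment (n : ℕ) : Tendsto (fun Λ : FiniteIndexSubgroup d =>
      (∑ ψ ∈ Finset.univ.erase (0 : AddChar ((Fin d → ℤ) ⧸ Λ.1) ℂ),
        lazySymbol (basisClass Λ.1) ψ ^ n) / Nat.card ((Fin d → ℤ) ⧸ Λ.1)) (minLengthAtTop d)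
      (𝓝 (lazyReturnProb d n)) := by
    have h : Tendsto (fun Λ : FiniteIndexSubgroup d =>
        lazyReturnProb d n - 1 / (Nat.card ((Fin d → ℤ) ⧸ Λ.1) : ℝ)) (minLengthAtTop d)
        (𝓝 (lazyReturnProb d n - 0)) := tendsto_const_nhds.sub hinv
    rw [sub_zero] at h
    refine h.congr' ?_
    filter_upwards [eventually_dualMean_eq_lazyReturnProb (d := d) n] with Λ hΛ
    have hone : lazySymbol (basisClass Λ.1) 0 = 1 := by
      simp [lazySymbol, lazyFactor, hdpos.ne']
    rw [← hΛ, dualMean, ← Finset.add_sum_erase _ _ (Finset.mem_univ 0), hone, one_pow]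
    ring
  have hseries : Tendsto (fun Λ : FiniteIndexSubgroup d => ∑' n : ℕ,
      (∑ ψ ∈ Finset.univ.erase (0 : AddChar ((Fin d → ℤ) ⧸ Λ.1) ℂ),
        lazySymbol (basisClass Λ.1) ψ ^ (n + 1)) / Nat.card ((Fin d → ℤ) ⧸ Λ.1) / (n + 1))
      (minLengthAtTop d) (𝓝 (∑' n : ℕ, lazyReturnProb d (n + 1) / (n + 1))) := by
    refine tendsto_tsum_of_dominated_convergence
      (summable_rpow_neg_quarter_div.mul_left (4 * d * (1 / (d : ℝ)) ^ (-(1 / 4) : ℝ)))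
      (fun n => (hmoment (n + 1)).div_const _) (Eventually.of_forall fun Λ n => ?_)
    have h0 : 0 ≤ (∑ ψ ∈ Finset.univ.erase (0 : AddChar ((Fin d → ℤ) ⧸ Λ.1) ℂ),
        lazySymbol (basisClass Λ.1) ψ ^ (n + 1)) / Nat.card ((Fin d → ℤ) ⧸ Λ.1) :=
      div_nonneg (Finset.sum_nonneg fun ψ _ => pow_nonneg (lazySymbol_nonneg _ ψ) _)
        (Nat.cast_nonneg _)
    rw [Real.norm_of_nonneg (div_nonneg h0 (by positivity)), ← mul_div_assoc]
    refine div_le_div_of_nonneg_right ?_ (by positivity)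
    have h := sum_nontrivial_lazySymbol_pow_le (exists_basisClass_ne_one Λ) n.succ_ne_zero
    rw [Fintype.card_fin, div_eq_mul_one_div ((n.succ : ℕ) : ℝ),
      Real.mul_rpow (Nat.cast_nonneg _) (by positivity)] at h
    push_cast at h
    linarith
  have h := (((tendsto_const_nhds (x := (1 : ℝ))).sub hinv).mul_const
    (Real.log (4 * d))).sub hseries |>.sub hlog
  rw [sub_zero, sub_zero, one_mul] at h
  exact h.congr fun Λ => (logComplexityDensity_gridGraph hd Λ).symm

theorem growthRate_gridGraph (hd : 1 ≤ d) : (gridGraph d).growthRate =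
    Real.log (4 * d) - ∑' n : ℕ, lazyReturnProb d (n + 1) / (n + 1) := by
  have := minLengthAtTop_neBot hd
  exact (tendsto_logComplexityDensity_gridGraph hd).limsup_eq

theorem log_four_mul (hd : 1 ≤ d) : Real.log (4 * d) = Real.log (2 * d) + Real.log 2 := by
  have hdpos : (0 : ℝ) < d := Nat.cast_pos.2 hd
  rw [← Real.log_mul (by positivity) (by norm_num)]
  congr 1
  ring

end GrowthRate

/-- The first clause says that the upper limit defining the growth rate is a limit. -/
theorem theorem6p6 :
    (∀ d : ℕ, 1 ≤ d → Filter.Tendsto (gridGraph d).logComplexityDensity (minLengthAtTop d)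
      (nhds (gridGraph d).growthRate)) ∧
    (∀ d : ℕ, 1 ≤ d → (gridGraph d).growthRate ≤ Real.log (2 * (d : ℝ))) ∧
    Filter.Tendsto (fun d : ℕ => (gridGraph d).growthRate - Real.log (2 * (d : ℝ)))
      Filter.atTop (nhds 0) := by
  refine ⟨fun d hd => ?_, fun d hd => ?_, ?_⟩
  · rw [growthRate_gridGraph hd]
    exact tendsto_logComplexityDensity_gridGraph hd
  · rw [growthRate_gridGraph hd, log_four_mul hd]
    linarith [log_two_le_tsum_lazyReturnProb hd]
  · have h := tendsto_tsum_lazyReturnProb.const_sub (Real.log 2)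
    rw [sub_self] at h
    refine h.congr' ?_
    filter_upwards [eventually_ge_atTop 1] with d hd
    rw [growthRate_gridGraph hd, log_four_mul hd]
    ring
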